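/- In the Multiphase game on $\mathsf{DISJ}_n$ there are sets $S_1,\dots,S_k\subseteq[n]$ (write $\vec S=(S_1,\dots,S_k)$), a set $T\subseteq[n]$ and an index $i\in[k]$, and the goal is to decide whether $S_i\cap T=\emptyset$. A 4-party number-on-forehead protocol $\Gamma=(U,\Pi)$ for this game is deterministic and works as follows. Charlie, who sees $\vec S$ and $T$ but not $i$, privately sends Bob a bit string $U=U(\vec S,T)$ (the advice). Megan, who sees $\vec S$ and $i$, broadcasts one bit string $\Pi_i^{\mathcal M}=\Pi^{\mathcal M}(\vec S,i)$ to Alice and Bob. Then Alice, who sees $S_i$, $i$ and Megan's message, and Bob, who sees $T$, $i$, $U$ and Megan's message, exchange bits as in an ordinary two-party protocol with any number of rounds, at the end of which one of them announces the answer. Let $|U|$ be the maximum over $(\vec S,T)$ of the length of the advice, and let $|\Pi_i|$ be the maximum over $(\vec S,T)$ of the total number of bits sent by Megan, Alice and Bob when the index is $i$. The protocol solves the game if the answer is correct for all $\vec S$, $T$ and $i$ (zero error). **Theorem.** There is an absolute constant $c>0$ with the following property. Let $k,u:\mathbb N\to\mathbb N$ be functions with $k(n)=\omega(n)$ and $u(n)=o(k(n))$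 as $n\to\infty$. Then for all sufficiently large $n$, every 4-party protocol $\Gamma=(U,\Pi)$ that solves the Multiphase game on $\mathsf{DISJ}_n$ with $k(n)$ sets and has $|U|\le u(n)$ satisfies $|\Pi_i|\ge c\sqrt n$ for some index $i\in[k(n)]$. -/

import Mathlib

open Filter Asymptotics

/-- `DISJ_n` on two subsets of `[n]`: the answer is `true` exactly when the sets are disjoint. -/
def disj {n : ℕ} (S T : Finset (Fin n)) : Bool := decide (Disjoint S T)

/-- A deterministic two-party protocol tree, for an Alice holding an element of `A` and a Bob holding
an element of `B`. Each inner node belongs to one of the two players, who sends one bit computed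
from his or her own input, and the bit selects the subtree in which they continue. (The dependence on
the history is the dependence on the node.) At a leaf one of the players announces the answer; no bit
is charged for that. -/
inductive TwoParty (A B : Type) : Type
  | aliceAnswers (f : A → Bool) : TwoParty A B
  | bobAnswers (g : B → Bool) : TwoParty A B
  | aliceSpeaks (f : A → Bool) (next : Bool → TwoParty A B) : TwoParty A B
  | bobSpeaks (g : B → Bool) (next : Bool → TwoParty A B) : TwoParty A B

namespace TwoParty

/-- The sequence of bits exchanged on inputs `a` and `b`. -/
def transcript {A B : Type} : TwoParty A B → A → B → List Bool
  | aliceAnswers _, _, _ => []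
  | bobAnswers _, _, _ => []
  | aliceSpeaks f next, a, b => f a :: (next (f a)).transcript a b
  | bobSpeaks g next, a, b => g b :: (next (g b)).transcript a b

/-- The answer given on inputs `a` and `b`. -/
def answer {A B : Type} : TwoParty A B → A → B → Bool
  | aliceAnswers f, a, _ => f a
  | bobAnswers g, _, b => g b
  | aliceSpeaks f next, a, b => (next (f a)).answer a b
  | bobSpeaks g next, a, b => (next (g b)).answer a b

end TwoParty

/-- A 4-party number-on-forehead protocol `Γ = (U, Π)` for the Multiphase game with `k` sets
`S₁, …, S_k ⊆ [n]`, a set `T ⊆ [n]` and an index `i`.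

* Charlie sees `S` and `T`, but not `i`, and privately sends Bob the advice `U(S, T)`.
* Megan sees `S` and `i` and broadcasts one message to Alice and Bob.
* Then Alice, who sees `S i` and `i`, and Bob, who sees `T`, `i` and the advice, talk to each other.
  Both know `i` and the broadcast message, so their protocol tree may depend on these two. -/
structure FourParty (n k : ℕ) where
  advice : (Fin k → Finset (Fin n)) → Finset (Fin n) → List Bool
  broadcast : (Fin k → Finset (Fin n)) → Fin k → List Bool
  talk : Fin k → List Bool → TwoParty (Finset (Fin n)) (Finset (Fin n) × List Bool)

namespace FourParty

variable {n k : ℕ}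

/-- The transcript `Π_i`: Megan's message, and the conversation of Alice and Bob. -/
def transcript (Γ : FourParty n k) (i : Fin k) (S : Fin k → Finset (Fin n))
    (T : Finset (Fin n)) : List Bool × List Bool :=
  (Γ.broadcast S i, (Γ.talk i (Γ.broadcast S i)).transcript (S i) (T, Γ.advice S T))

/-- The answer of the protocol when the index is `i`. -/
def answer (Γ : FourParty n k) (i : Fin k) (S : Fin k → Finset (Fin n))
    (T : Finset (Fin n)) : Bool :=
  (Γ.talk i (Γ.broadcast S i)).answer (S i) (T, Γ.advice S T)

/-- The protocol solves the Multiphase game on `DISJ_n` with zero error. -/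
def SolvesDisj (Γ : FourParty n k) : Prop :=
  ∀ (i : Fin k) (S : Fin k → Finset (Fin n)) (T : Finset (Fin n)), Γ.answer i S T = disj (S i) T

/-- `|U|`: the number of bits of Charlie's advice, in the worst case. -/
def adviceLength (Γ : FourParty n k) : ℕ :=
  Finset.univ.sup fun x : (Fin k → Finset (Fin n)) × Finset (Fin n) => (Γ.advice x.1 x.2).length

/-- `|Π_i|`: the number of bits that Megan, Alice and Bob send when the index is `i`, in the worst
case over `S` and `T`. -/
def length (Γ : FourParty n k) (i : Fin k) : ℕ :=
  Finset.univ.sup fun x : (Fin k → Finset (Fin n)) × Finset (Fin n) =>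
    (Γ.transcript i x.1 x.2).1.length + (Γ.transcript i x.1 x.2).2.length

end FourParty

/-! The proof makes the protocol face a pair of sets that are almost independent, where it becomes a
short two-party protocol for sparse disjointness, and then applies a corruption bound. With `b`
about `√n`, the `S_j` are independent random sets containing each point with probability `1/b`, and
`T` is the range of `b` independent uniform points, so a pair is disjoint with probability at least
`1/4`.

Decoupling (`exists_almost_independent`). The pair `Y = (T, U)` has at most about `|U|` bits of
information on all the `S_j` together. Reveal sets and their broadcast messages one index at a time.
If every step gave more than `ε` information on `Y`, then about `k/2` steps would exceed `|U|`. So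
for some index `i` and some `V`, made of the revealed data and Megan's message for `i`, the sets
satisfy `I(S_i ; Y | V) ≤ ε`, while `S_i` given `V` still has nearly full entropy.

Zero error (`sum_unsupported_le`). Resample `S_i` and `Y` independently given `V`. A combination of
values that really occurs is answered correctly, and combinations that never occur carry mass at
most `I(S_i ; Y | V) ≤ ε`. So the resampled protocol errs with probability at most `ε`. Since `V`
fixes the broadcast, on each fibre of `V` it is a two-party protocol with few transcripts, hence few
rectangles.

Corruption (`rectangle_disjoint_le`). On a fibre `T` is uniform, because `V` depends on the `S_j`
only, and off few points the law of `S_i` has density at most `e^(b/256)`. Under such laws every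
rectangle has at most nine times as many disjoint pairs as intersecting ones, up to an error
exponentially small in `b`. The behaviour behind it is `card_avoiding_le`: few sequences `t` miss
most sets of a spread-out family.

Accepted disjoint pairs are therefore at most nine times the errors plus `2^(L+1)` exponentially
small terms. Against the quarter of pairs that are disjoint, this rules out `L ≤ c√n` for small `c`
(`quarter_le_of_solvesDisj`). -/

/-! ### Entropy on a finite uniform space. -/

namespace FiniteEntropy

open Finset

variable {Ω α β γ : Type*} [Fintype Ω]

open Classical in
/-- The points that `X` does not separate from `ω`. -/
noncomputable def fiber (X : Ω → α) (ω : Ω) : Finset Ω := univ.filter fun ω' => X ω' = X ω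

/-- The Shannon entropy (in nats) of `X` on the finite uniform probability space `Ω`. -/
noncomputable def entropy (X : Ω → α) : ℝ :=
  (∑ ω, Real.log (Fintype.card Ω / #(fiber X ω))) / Fintype.card Ω

@[simp] lemma mem_fiber {X : Ω → α} {ω ω' : Ω} : ω' ∈ fiber X ω ↔ X ω' = X ω := by
  simp [fiber]

lemma fiber_congr {X : Ω → α} {ω ω' : Ω} (h : X ω' = X ω) : fiber X ω' = fiber X ω := by
  ext; simp [h]

lemma fiber_card_pos (X : Ω → α) (ω : Ω) : (0 : ℝ) < #(fiber X ω) := by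
  exact_mod_cast card_pos.2 ⟨ω, by simp⟩

lemma fiber_card_le (X : Ω → α) (ω : Ω) : (#(fiber X ω) : ℝ) ≤ Fintype.card Ω := by
  exact_mod_cast card_le_univ _

lemma sum_inv_fiber_card_le {X : Ω → α} {R : Finset α} (hR : ∀ ω, X ω ∈ R) :
    ∑ ω, (1 / #(fiber X ω) : ℝ) ≤ #R := by
  classical
  rw [← sum_fiberwise_of_maps_to (s := univ) (t := R) (g := X) (fun ω _ => hR ω)]
  have : ∀ r ∈ R, ∑ ω ∈ univ.filter (fun ω => X ω = r), (1 / #(fiber X ω) : ℝ) ≤ 1 := by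
    intro r _
    by_cases h : (univ.filter (fun ω => X ω = r)).Nonempty
    · obtain ⟨ω₀, h₀⟩ := h
      have hc : ∀ ω ∈ univ.filter (fun ω => X ω = r),
          (1 / #(fiber X ω) : ℝ) = 1 / #(univ.filter (fun ω => X ω = r)) := by
        intro ω hω
        congr 3
        ext; simp_all
      rw [sum_congr rfl hc, sum_const, nsmul_eq_mul]
      exact le_of_eq (mul_one_div_cancel (by
        exact_mod_cast (card_pos.2 ⟨ω₀, h₀⟩).ne'))
    · rw [not_nonempty_iff_eq_empty.1 h]; simp
  calc _ ≤ ∑ r ∈ R, (1 : ℝ) := sum_le_sum this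
    _ = _ := by simp

lemma entropy_eq_of_iff {X : Ω → α} {Y : Ω → β} (h : ∀ ω ω', X ω' = X ω ↔ Y ω' = Y ω) :
    entropy X = entropy Y := by
  have : ∀ ω, fiber X ω = fiber Y ω := fun ω => by ext; simp [h]
  simp [entropy, this]

variable [Nonempty Ω]

lemma card_space_pos : (0 : ℝ) < Fintype.card Ω := by
  exact_mod_cast Fintype.card_pos

lemma entropy_nonneg (X : Ω → α) : 0 ≤ entropy X := by
  refine div_nonneg (sum_nonneg fun ω _ => Real.log_nonneg ?_) (by positivity)
  rw [one_le_div (fiber_card_pos X ω)]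
  exact fiber_card_le X ω

lemma entropy_mono {X : Ω → α} {Y : Ω → β} (h : ∀ ω ω', Y ω' = Y ω → X ω' = X ω) :
    entropy X ≤ entropy Y := by
  refine div_le_div_of_nonneg_right (sum_le_sum fun ω _ => ?_) (by positivity)
  have hp := card_space_pos (Ω := Ω)
  have := fiber_card_pos X ω
  have := fiber_card_pos Y ω
  refine Real.log_le_log (by positivity) (div_le_div_of_nonneg_left (by positivity) this ?_)
  exact_mod_cast card_le_card fun ω' hω' => by
    rw [mem_fiber] at *
    exact h _ _ hω'

lemma entropy_le_log {X : Ω → α} {R : Finset α} (hR : ∀ ω, X ω ∈ R) :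
    entropy X ≤ Real.log #R := by
  have hp := card_space_pos (Ω := Ω)
  have hRp : (0 : ℝ) < #R := by
    exact_mod_cast card_pos.2 ⟨_, hR (Classical.arbitrary Ω)⟩
  rw [entropy, div_le_iff₀ hp]
  -- Jensen's inequality in the form `log x ≤ x - 1`, at the ratio of `1 / P(X = X ω)` to `#R`.
  have h1 : ∀ ω, Real.log (Fintype.card Ω / #(fiber X ω)) ≤
      Real.log #R + (Fintype.card Ω / #R * (1 / #(fiber X ω)) - 1) := by
    intro ω
    have := fiber_card_pos X ω
    have h2 := Real.log_le_sub_one_of_pos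
      (show 0 < (Fintype.card Ω / #(fiber X ω) : ℝ) / #R by positivity)
    rw [Real.log_div (by positivity) (by positivity)] at h2
    have : (Fintype.card Ω / #(fiber X ω) : ℝ) / #R =
      Fintype.card Ω / #R * (1 / #(fiber X ω)) := by field_simp
    linarith
  refine (sum_le_sum fun ω _ => h1 ω).trans ?_
  rw [sum_add_distrib, sum_sub_distrib, ← mul_sum]
  have h3 : (Fintype.card Ω / #R : ℝ) * ∑ ω, (1 / #(fiber X ω) : ℝ) ≤ Fintype.card Ω := by
    calc _ ≤ (Fintype.card Ω / #R : ℝ) * #R := by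
          gcongr; exact sum_inv_fiber_card_le hR
      _ = _ := by field_simp
  simp only [sum_const, card_univ, nsmul_eq_mul, mul_one]
  linarith

lemma entropy_le_log_card [Fintype α] (X : Ω → α) : entropy X ≤ Real.log (Fintype.card α) :=
  entropy_le_log (R := univ) fun _ => mem_univ _

lemma entropy_of_injective {X : Ω → α} (h : Function.Injective X) :
    entropy X = Real.log (Fintype.card Ω) := by
  have : ∀ ω, fiber X ω = {ω} := fun ω => by ext; simp [h.eq_iff]
  have hp := card_space_pos (Ω := Ω)
  simp [entropy, this]

open Classical in
/-- Conditional mutual information controls the mass that, once `X` and `Y` are resampled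
independently given `V`, falls on triples of values that do not occur. -/
lemma sum_unsupported_le (X : Ω → α) (Y : Ω → β) (V : Ω → γ) :
    (∑ ω, (#((fiber V ω).filter fun ω' => ¬ ∃ ω'', X ω'' = X ω ∧ Y ω'' = Y ω' ∧ V ω'' = V ω) : ℝ)
        / #(fiber V ω)) ≤
      Fintype.card Ω * (entropy (fun ω => (X ω, V ω)) + entropy (fun ω => (Y ω, V ω))
        - entropy (fun ω => (X ω, Y ω, V ω)) - entropy V) := by
  have hp := card_space_pos (Ω := Ω)
  set a : Ω → ℝ := fun ω => #(fiber (fun ω => (X ω, V ω)) ω) with ha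
  set b : Ω → ℝ := fun ω => #(fiber (fun ω => (Y ω, V ω)) ω) with hb
  set c : Ω → ℝ := fun ω => #(fiber (fun ω => (X ω, Y ω, V ω)) ω) with hc
  set d : Ω → ℝ := fun ω => #(fiber V ω) with hd
  have ap : ∀ ω, 0 < a ω := fun ω => fiber_card_pos _ ω
  have bp : ∀ ω, 0 < b ω := fun ω => fiber_card_pos _ ω
  have cp : ∀ ω, 0 < c ω := fun ω => fiber_card_pos _ ω
  have dp : ∀ ω, 0 < d ω := fun ω => fiber_card_pos _ ω
  have hI : Fintype.card Ω * (entropy (fun ω => (X ω, V ω)) + entropy (fun ω => (Y ω, V ω))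
        - entropy (fun ω => (X ω, Y ω, V ω)) - entropy V) =
      ∑ ω, (Real.log (c ω) + Real.log (d ω) - Real.log (a ω) - Real.log (b ω)) := by
    simp only [entropy]
    rw [← add_div, ← sub_div, ← sub_div, mul_div_cancel₀ _ hp.ne', ← sum_add_distrib,
      ← sum_sub_distrib, ← sum_sub_distrib]
    refine sum_congr rfl fun ω _ => ?_
    rw [Real.log_div hp.ne' (ap ω).ne', Real.log_div hp.ne' (bp ω).ne',
      Real.log_div hp.ne' (cp ω).ne', Real.log_div hp.ne' (dp ω).ne']
    ring
  rw [hI]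
  -- The ratio is the conditional product mass of the triple at `ω` over its true mass. The mean of
  -- minus its logarithm is the conditional mutual information.
  have hlog : ∀ ω, 1 - a ω * b ω / (c ω * d ω) ≤
      Real.log (c ω) + Real.log (d ω) - Real.log (a ω) - Real.log (b ω) := by
    intro ω
    have := ap ω; have := bp ω; have := cp ω; have := dp ω
    have h := Real.log_le_sub_one_of_pos (show 0 < a ω * b ω / (c ω * d ω) by positivity)
    rw [Real.log_div (by positivity) (by positivity), Real.log_mul (by positivity) (by positivity),
      Real.log_mul (by positivity) (by positivity)] at h
    linarith
  refine le_trans ?_ (sum_le_sum fun ω _ => hlog ω)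
  set P : Ω → Ω → Prop := fun ω ω' => ∃ ω'', X ω'' = X ω ∧ Y ω'' = Y ω' ∧ V ω'' = V ω with hP
  have hsplit : ∀ ω, (#((fiber V ω).filter fun ω' => ¬ P ω ω') : ℝ) / d ω =
      1 - (#((fiber V ω).filter fun ω' => P ω ω') : ℝ) / d ω := by
    intro ω
    have h : (#((fiber V ω).filter fun ω' => P ω ω') : ℝ)
        + #((fiber V ω).filter fun ω' => ¬ P ω ω') = d ω := by
      rw [← Nat.cast_add, card_filter_add_card_filter_not]
    have := dp ω
    field_simp
    linarith
  rw [sum_congr rfl fun ω _ => hsplit ω, sum_sub_distrib, sum_sub_distrib]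
  refine sub_le_sub_left ?_ _
  -- Triple count: `a * b` counts the pairs `(ω, ω')` that agree with `ω''` in `(X, V)` and in `(Y,
  -- V)`. After exchanging the sums, the `ω''` matching a fixed pair are either none or one fibre of
  -- size `c`, so a supported pair contributes `1 / d` and any other contributes `0`.
  have h1 : ∀ ω'', a ω'' * b ω'' / (c ω'' * d ω'') = ∑ ω, ∑ ω',
      if (X ω'' = X ω ∧ V ω'' = V ω) ∧ (Y ω'' = Y ω' ∧ V ω'' = V ω')
        then 1 / (c ω'' * d ω'') else 0 := by
    intro ω''
    have h2 : a ω'' = ∑ ω, if (X ω'' = X ω ∧ V ω'' = V ω) then (1 : ℝ) else 0 := by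
      simp only [ha, fiber, sum_boole, Prod.mk.injEq]
      simp only [eq_comm]
    have h3 : b ω'' = ∑ ω, if (Y ω'' = Y ω ∧ V ω'' = V ω) then (1 : ℝ) else 0 := by
      simp only [hb, fiber, sum_boole, Prod.mk.injEq]
      simp only [eq_comm]
    rw [div_eq_mul_one_div, h2, h3, sum_mul_sum, sum_mul]
    refine sum_congr rfl fun ω _ => ?_
    rw [sum_mul]
    refine sum_congr rfl fun ω' _ => ?_
    by_cases h4 : X ω'' = X ω ∧ V ω'' = V ω <;> by_cases h5 : Y ω'' = Y ω' ∧ V ω'' = V ω' <;>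
      simp [h4, h5]
  rw [sum_congr rfl fun ω'' _ => h1 ω'', sum_comm]
  refine sum_le_sum fun ω _ => ?_
  rw [sum_comm, div_eq_mul_one_div, card_filter, Nat.cast_sum, sum_mul, fiber, sum_filter]
  refine sum_le_sum fun ω' _ => ?_
  rw [← sum_filter]
  by_cases hne : (univ.filter fun ω'' =>
      (X ω'' = X ω ∧ V ω'' = V ω) ∧ (Y ω'' = Y ω' ∧ V ω'' = V ω')).Nonempty
  · obtain ⟨ω₀, h₀⟩ := hne
    simp only [mem_filter, mem_univ, true_and] at h₀
    obtain ⟨⟨hx, hv⟩, hy, hv'⟩ := h₀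
    have hs : (univ.filter fun ω'' =>
      (X ω'' = X ω ∧ V ω'' = V ω) ∧ (Y ω'' = Y ω' ∧ V ω'' = V ω')) =
        fiber (fun ω => (X ω, Y ω, V ω)) ω₀ := by
      ext ω''
      simp only [mem_filter, mem_univ, true_and, mem_fiber, Prod.mk.injEq, hx, hy]
      rw [← hv', hv]
      tauto
    rw [hs, if_pos (by rw [← hv, hv']), if_pos ⟨ω₀, hx, hy, hv⟩]
    have hcst : ∀ ω'' ∈ fiber (fun ω => (X ω, Y ω, V ω)) ω₀,
        1 / (c ω'' * d ω'') = 1 / (c ω₀ * d ω) := by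
      intro ω'' h
      rw [mem_fiber] at h
      have hv2 : V ω'' = V ω := by
        simp only [Prod.mk.injEq] at h
        rw [h.2.2, hv]
      simp only [hc, hd]
      rw [fiber_congr h, fiber_congr hv2]
    rw [sum_congr rfl hcst, sum_const, nsmul_eq_mul]
    have := cp ω₀
    have := dp ω
    change c ω₀ * _ ≤ _
    apply le_of_eq
    push_cast
    field_simp
  · rw [not_nonempty_iff_eq_empty.1 hne, sum_empty]
    have := dp ω
    split_ifs <;> simp [this.le]

/-- The form used for zero-error protocols: `bad` is any event that no actual sample point can
realize. -/
lemma sum_le_of_unsupported (X : Ω → α) (Y : Ω → β) (V : Ω → γ) {bad : Ω → Ω → Prop}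
    [∀ ω ω', Decidable (bad ω ω')]
    (h : ∀ ω ω', bad ω ω' → ∀ ω'', X ω'' = X ω → Y ω'' = Y ω' → V ω'' ≠ V ω) :
    ∑ ω, (#((fiber V ω).filter (bad ω)) : ℝ) / #(fiber V ω) ≤
      Fintype.card Ω * (entropy (fun ω => (X ω, V ω)) + entropy (fun ω => (Y ω, V ω))
        - entropy (fun ω => (X ω, Y ω, V ω)) - entropy V) := by
  classical
  refine le_trans (sum_le_sum fun ω _ => div_le_div_of_nonneg_right ?_ (Nat.cast_nonneg _))
    (sum_unsupported_le X Y V)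
  refine Nat.cast_le.2 (card_le_card fun ω' h' => ?_)
  rw [mem_filter] at h' ⊢
  refine ⟨h'.1, ?_⟩
  rintro ⟨ω'', h1, h2, h3⟩
  exact h ω ω' h'.2 ω'' h1 h2 h3

/-- The unsupported mass is nonnegative, so the conditional mutual information bounding it is too.
-/
lemma entropy_submodular (X : Ω → α) (Y : Ω → β) (V : Ω → γ) :
    entropy (fun ω => (X ω, Y ω, V ω)) + entropy V ≤
      entropy (fun ω => (X ω, V ω)) + entropy (fun ω => (Y ω, V ω)) := by
  classical
  have h := sum_unsupported_le X Y V
  have h0 := (sum_nonneg fun ω _ => by positivity).trans h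
  have := nonneg_of_mul_nonneg_right h0 card_space_pos
  linarith

lemma entropy_pair_le (X : Ω → α) (Y : Ω → β) :
    entropy (fun ω => (X ω, Y ω)) ≤ entropy X + entropy Y := by
  have h := entropy_submodular X Y (fun _ => ())
  have h1 : entropy (fun ω => (X ω, Y ω, ())) = entropy (fun ω => (X ω, Y ω)) :=
    entropy_eq_of_iff (by simp)
  have h2 : entropy (fun ω => (X ω, ())) = entropy X := entropy_eq_of_iff (by simp)
  have h3 : entropy (fun ω => (Y ω, ())) = entropy Y := entropy_eq_of_iff (by simp)
  have := entropy_nonneg (fun _ : Ω => ())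
  linarith

open Classical in
/-- If `X` and `V` have small mutual information, then at most points the conditional law of `X`
given `V` does not exceed the uniform law by much. -/
lemma card_dense_le [Fintype α] [Nonempty α] (X : Ω → α) (V : Ω → γ) (K : ℝ) :
    K * #(univ.filter fun ω => ¬ (#(fiber (fun ω => (X ω, V ω)) ω) * Fintype.card α : ℝ) ≤
        Real.exp K * #(fiber V ω)) ≤
      Fintype.card Ω * (Real.log (Fintype.card α) + entropy V
        - entropy (fun ω => (X ω, V ω)) + 1) := by
  have hp := card_space_pos (Ω := Ω)
  have hα := card_space_pos (Ω := α)
  set a : Ω → ℝ := fun ω => #(fiber (fun ω => (X ω, V ω)) ω) with ha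
  set d : Ω → ℝ := fun ω => #(fiber V ω) with hd
  have ap : ∀ ω, 0 < a ω := fun ω => fiber_card_pos _ ω
  have dp : ∀ ω, 0 < d ω := fun ω => fiber_card_pos _ ω
  have hI : Fintype.card Ω * (Real.log (Fintype.card α) + entropy V
        - entropy (fun ω => (X ω, V ω)) + 1) =
      ∑ ω, (Real.log (Fintype.card α) + Real.log (a ω) - Real.log (d ω) + 1) := by
    have h1 : Fintype.card Ω * entropy V = ∑ ω, (Real.log (Fintype.card Ω) - Real.log (d ω)) := by
      rw [entropy, mul_div_cancel₀ _ hp.ne']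
      exact sum_congr rfl fun ω _ => Real.log_div hp.ne' (dp ω).ne'
    have h2 : Fintype.card Ω * entropy (fun ω => (X ω, V ω)) =
        ∑ ω, (Real.log (Fintype.card Ω) - Real.log (a ω)) := by
      rw [entropy, mul_div_cancel₀ _ hp.ne']
      exact sum_congr rfl fun ω _ => Real.log_div hp.ne' (ap ω).ne'
    rw [mul_add, mul_sub, mul_add, h1, h2]
    simp only [sum_add_distrib, sum_sub_distrib, sum_const, card_univ, nsmul_eq_mul]
    ring
  have hsum : ∑ ω, d ω / (a ω * Fintype.card α) ≤ Fintype.card Ω := by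
    have h1 : ∀ ω, d ω / (a ω * Fintype.card α) = ∑ ω',
        if V ω' = V ω then 1 / (a ω * Fintype.card α) else 0 := by
      intro ω
      rw [← sum_filter, sum_const, nsmul_eq_mul, mul_one_div]
      congr 3
    rw [sum_congr rfl fun ω _ => h1 ω, sum_comm]
    calc _ ≤ ∑ ω' : Ω, (1 : ℝ) := sum_le_sum fun ω' _ => ?_
      _ = _ := by simp
    calc _ = ∑ ω ∈ univ.filter (fun ω => V ω' = V ω), ((1 / (Fintype.card α) : ℝ) * (1 / a ω)) := by
            rw [sum_filter]
            refine sum_congr rfl fun ω _ => ?_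
            split_ifs
            · have := ap ω; field_simp
            · rfl
      _ = (1 / (Fintype.card α) : ℝ) *
            ∑ x : α, ∑ ω ∈ (univ.filter (fun ω => V ω' = V ω)).filter (fun ω => X ω = x),
              1 / a ω := by
            rw [← mul_sum, sum_fiberwise (univ.filter fun ω => V ω' = V ω) X fun ω => 1 / a ω]
      _ ≤ (1 / (Fintype.card α) : ℝ) * ∑ x : α, 1 := by
            gcongr with x
            have hc : ∀ ω ∈ (univ.filter (fun ω => V ω' = V ω)).filter (fun ω => X ω = x),
                1 / a ω = 1 / #((univ.filter (fun ω => V ω' = V ω)).filter (fun ω => X ω = x)) := by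
              intro ω hω
              simp only [mem_filter, mem_univ, true_and] at hω
              simp only [ha]
              congr 3
              ext ω₂
              simp only [mem_fiber, Prod.mk.injEq, mem_filter, mem_univ, true_and, hω.2, ← hω.1]
              tauto
            rw [sum_congr rfl hc, sum_const, nsmul_eq_mul]
            rw [mul_one_div]; exact div_self_le_one _
      _ = 1 := by simp
  rw [hI]
  -- The log-density can be negative, so Markov's inequality does not apply to it directly. Adding
  -- the reciprocal of the density makes it positive, as `log x + 1 / x ≥ 1`. The reciprocal has
  -- mean at most `1` by `hsum`, which is the `+ 1` in the bound.
  have hkey : ∀ ω, (if ¬ (a ω * Fintype.card α ≤ Real.exp K * d ω) then K else 0) ≤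
      (Real.log (Fintype.card α) + Real.log (a ω) - Real.log (d ω)) +
        d ω / (a ω * Fintype.card α) := by
    intro ω
    have := ap ω
    have := dp ω
    have hq : 0 < d ω / (a ω * Fintype.card α) := by positivity
    by_cases h : a ω * Fintype.card α ≤ Real.exp K * d ω
    rotate_left
    · rw [if_pos h]
      have h1 := Real.log_le_log (by positivity) (not_le.1 h).le
      rw [Real.log_mul (by positivity) (by positivity), Real.log_exp,
        Real.log_mul (by positivity) (by positivity)] at h1
      linarith
    · rw [if_neg (not_not.2 h)]
      have h2 := Real.log_le_sub_one_of_pos hq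
      rw [Real.log_div (by positivity) (by positivity),
        Real.log_mul (by positivity) (by positivity)] at h2
      linarith
  have := sum_le_sum fun ω (_ : ω ∈ univ) => hkey ω
  rw [← sum_filter, sum_const, nsmul_eq_mul, sum_add_distrib] at this
  rw [sum_add_distrib (g := fun _ => (1 : ℝ))]
  simp only [sum_const, card_univ, nsmul_eq_mul, mul_one] at *
  linarith

end FiniteEntropy

/-! ### Sparse random sets against spread-out weights. -/

namespace SparseDisjointness

open Finset

variable {n b : ℕ}

/-- The random sparse subset of `Fin n` that a uniformly random map `Fin n → Fin b` encodes. -/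
def zeroSet (x : Fin n → Fin b) : Finset (Fin n) := univ.filter fun j => (x j : ℕ) = 0

@[simp] lemma mem_zeroSet {x : Fin n → Fin b} {j : Fin n} : j ∈ zeroSet x ↔ (x j : ℕ) = 0 := by
  simp [zeroSet]

lemma sum_fin_ite_zero (hb : 0 < b) (a : ℝ) :
    ∑ c : Fin b, (if (c : ℕ) = 0 then a else 1) = b - 1 + a := by
  obtain ⟨m, rfl⟩ := Nat.exists_eq_succ_of_ne_zero hb.ne'
  rw [Fin.sum_univ_succ]
  simp
  ring

/-- The coordinates are independent, and each one in `J` gives the factor `1 - (1 - 1/e) / b`. The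
constant `63/100` is a lower estimate of `1 - 1/e`. -/
lemma sum_exp_neg_card_le (hb : 0 < b) (J : Finset (Fin n)) :
    ∑ x : Fin n → Fin b, Real.exp (-(#(J ∩ zeroSet x) : ℝ)) ≤
      b ^ n * Real.exp (-(63 / 100 * #J / b)) := by
  have hb' : (0 : ℝ) < b := by exact_mod_cast hb
  have h1 : ∀ x : Fin n → Fin b, Real.exp (-(#(J ∩ zeroSet x) : ℝ)) =
      ∏ j, if j ∈ J then (if (x j : ℕ) = 0 then Real.exp (-1) else 1) else 1 := by
    intro x
    rw [prod_ite_mem, univ_inter, ← prod_filter, prod_const, ← Real.exp_nat_mul]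
    congr 1
    rw [mul_neg_one]
    congr 3
    ext; simp
  rw [sum_congr rfl fun x _ => h1 x]
  rw [← Fintype.prod_sum (f := fun j (c : Fin b) =>
    if j ∈ J then (if (c : ℕ) = 0 then Real.exp (-1) else 1) else 1)]
  have h2 : ∀ j : Fin n, (∑ c : Fin b,
      if j ∈ J then (if (c : ℕ) = 0 then Real.exp (-1) else 1) else 1) ≤
        b * if j ∈ J then Real.exp (-(63 / 100 / b)) else 1 := by
    intro j
    split_ifs
    · rw [sum_fin_ite_zero hb]
      have h3 := Real.add_one_le_exp (-(63 / 100 / b : ℝ))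
      have h4 := Real.exp_neg_one_lt_d9
      calc (b : ℝ) - 1 + Real.exp (-1) ≤ b * (-(63 / 100 / b) + 1) := by
            field_simp; linarith
        _ ≤ _ := by gcongr
    · simp
  refine (prod_le_prod (fun j _ => sum_nonneg fun c _ => ?_) fun j _ => h2 j).trans ?_
  · split_ifs <;> positivity
  rw [prod_mul_distrib, prod_const, card_univ, Fintype.card_fin, prod_ite_mem, univ_inter,
    prod_const, ← Real.exp_nat_mul]
  apply le_of_eq
  congr 2
  ring

/-- A weight of bounded density that is not too light gives almost every coordinate its fair share
of zeros. -/
lemma card_rarely_zero_le (hb : 0 < b) (hbn : b ^ 2 ≤ n) {w : (Fin n → Fin b) → ℝ} {W : ℝ}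
    (hw0 : ∀ x, 0 ≤ w x) (hw : ∀ x, w x ≤ W) (hW : 0 < W)
    (hF : Real.exp (-(b / 64 : ℝ)) * (W * b ^ n) ≤ ∑ x, w x) :
    (#(univ.filter fun j : Fin n =>
      ∑ x with j ∈ zeroSet x, w x < (∑ x, w x) / (2 * b)) : ℝ) ≤ n / 4 := by
  have hb' : (0 : ℝ) < b := by exact_mod_cast hb
  set F := ∑ x, w x with hFdef
  have hFpos : 0 < F := lt_of_lt_of_le (by positivity) hF
  set J := univ.filter fun j : Fin n => ∑ x with j ∈ zeroSet x, w x < F / (2 * b) with hJ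
  have hcount : ∑ x, w x * #(J ∩ zeroSet x) ≤ #J * (F / (2 * b)) := by
    have h1 : ∀ x, w x * (#(J ∩ zeroSet x) : ℝ) =
        ∑ j ∈ J, if j ∈ zeroSet x then w x else 0 := by
      intro x
      rw [← sum_filter, sum_const, nsmul_eq_mul, filter_mem_eq_inter, mul_comm]
    rw [sum_congr rfl fun x _ => h1 x, sum_comm, ← nsmul_eq_mul, ← sum_const]
    refine sum_le_sum fun j hj => ?_
    rw [← sum_filter]
    exact (mem_filter.1 hj).2.le
  -- Under `w / F` the mean of `#(J ∩ zeroSet x)` is at most `#J / (2b)`, so Jensen bounds the mean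
  -- of its negative exponential from below. Passing to the uniform law costs the density factor `W
  -- * b ^ n / F` and bounds it from above.
  have hjensen : Real.exp (-(#J / (2 * b) : ℝ)) * F ≤ W * (b ^ n * Real.exp (-(63 / 100 * #J / b))) := by
    have h1 := convexOn_exp.map_sum_le (t := univ) (w := fun x => w x / F)
      (p := fun x => -(#(J ∩ zeroSet x) : ℝ)) (fun x _ => div_nonneg (hw0 x) hFpos.le)
      (by rw [← sum_div, ← hFdef, div_self hFpos.ne']) (by simp)
    simp only [smul_eq_mul] at h1
    have h2 : -(#J / (2 * b) : ℝ) ≤ ∑ x, w x / F * -(#(J ∩ zeroSet x) : ℝ) := by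
      have : ∑ x, w x / F * -(#(J ∩ zeroSet x) : ℝ) = -((∑ x, w x * #(J ∩ zeroSet x)) / F) := by
        rw [sum_div, ← sum_neg_distrib]
        exact sum_congr rfl fun x _ => by ring
      rw [this, neg_le_neg_iff, div_le_iff₀ hFpos]
      calc _ ≤ _ := hcount
        _ = _ := by ring
    have h3 := (Real.exp_le_exp.2 h2).trans h1
    have h4 : ∑ x, w x / F * Real.exp (-(#(J ∩ zeroSet x) : ℝ)) ≤
        W / F * (b ^ n * Real.exp (-(63 / 100 * #J / b))) := by
      refine le_trans ?_ (mul_le_mul_of_nonneg_left (sum_exp_neg_card_le hb J) (by positivity))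
      rw [mul_sum]
      gcongr with x
      exact hw x
    have h5 := h3.trans h4
    rw [div_mul_eq_mul_div, le_div_iff₀ hFpos] at h5
    exact h5
  have h6 : Real.exp (-(#J / (2 * b) : ℝ)) * (Real.exp (-(b / 64 : ℝ)) * (W * b ^ n)) ≤
      Real.exp (-(63 / 100 * #J / b)) * (W * b ^ n) := by
    calc _ ≤ Real.exp (-(#J / (2 * b) : ℝ)) * F := by gcongr
      _ ≤ _ := hjensen
      _ = _ := by ring
  rw [← mul_assoc, ← Real.exp_add] at h6
  have h7 := Real.exp_le_exp.1 (le_of_mul_le_mul_right h6 (by positivity))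
  -- The gap is `63/100 - 1/2 = 13/100`. With `b² ≤ n` it gives `#J ≤ (100/832) n`, well below `n /
  -- 4`.
  have h8 : (13 / 100 * #J / b : ℝ) ≤ b / 64 := by
    have e1 : (#J / (2 * b) : ℝ) = 50 / 100 * #J / b := by ring
    have e2 : (63 / 100 * #J / b : ℝ) = 13 / 100 * #J / b + 50 / 100 * #J / b := by ring
    linarith
  rw [div_le_iff₀ hb'] at h8
  have h9 : (b : ℝ) ^ 2 ≤ n := by exact_mod_cast hbn
  nlinarith

/-- Against a weight that is spread out, few sequences `t` are avoided by almost all the mass. -/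
lemma card_avoiding_le (hb : 0 < b) (hbn : b ^ 2 ≤ n) {W θ : ℝ} (hW : 0 < W) (hθ : 0 < θ)
    (hF : Real.exp (-(b / 64 : ℝ)) * (W * b ^ n) ≤ θ) (r : ℕ) (w : (Fin n → Fin b) → ℝ)
    (hw0 : ∀ x, 0 ≤ w x) (hw : ∀ x, w x ≤ W) :
    (#(univ.filter fun t : Fin r → Fin n =>
      θ ≤ ∑ x with (∀ s, t s ∉ zeroSet x), w x) : ℝ) ≤
        (n * (53 / 100)) ^ r * ((∑ x, w x) / θ) ^ (2 * b) := by
  have hb' : (0 : ℝ) < b := by exact_mod_cast hb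
  by_cases hθF : ∑ x, w x < θ
  · rw [filter_eq_empty_iff.2]
    · have := sum_nonneg fun x (_ : x ∈ univ) => hw0 x
      simp only [card_empty, Nat.cast_zero]
      positivity
    · intro t _ h
      refine absurd (h.trans (sum_le_sum_of_subset_of_nonneg (filter_subset _ _) ?_)) hθF.not_ge
      exact fun x _ _ => hw0 x
  rw [not_lt] at hθF
  set F := ∑ x, w x with hFdef
  have hFpos : 0 < F := hθ.trans_le hθF
  -- The potential is `(F / θ) ^ (2b)`. The first entry `j` of the sequence deletes the points `x`
  -- with `j ∈ zeroSet x` from the weight, and the rest is a shorter sequence against the lighter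
  -- weight. `W` and `θ` stay fixed, so the density hypothesis survives as long as the mass is at
  -- least `θ`.
  induction r generalizing w with
  | zero =>
    calc _ ≤ (1 : ℝ) := by
          have := card_le_univ (univ.filter fun t : Fin 0 → Fin n =>
            θ ≤ ∑ x with (∀ s, t s ∉ zeroSet x), w x)
          simpa using (Nat.cast_le (α := ℝ)).2 this
      _ ≤ _ := by
          rw [pow_zero, one_mul]
          exact one_le_pow₀ ((one_le_div hθ).2 hθF)
  | succ r ih =>
    set v : Fin n → (Fin n → Fin b) → ℝ := fun j x => if j ∈ zeroSet x then 0 else w x with hv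
    have hv0 : ∀ j x, 0 ≤ v j x := fun j x => by
      simp only [hv]; split_ifs <;> simp [hw0]
    have hvw : ∀ j x, v j x ≤ w x := fun j x => by
      simp only [hv]; split_ifs <;> simp [hw0]
    have hrec : (#(univ.filter fun t : Fin (r + 1) → Fin n =>
        θ ≤ ∑ x with (∀ s, t s ∉ zeroSet x), w x) : ℝ) =
        ∑ j, (#(univ.filter fun t : Fin r → Fin n =>
          θ ≤ ∑ x with (∀ s, t s ∉ zeroSet x), v j x) : ℝ) := by
      rw [← sum_boole, ← (Fin.consEquiv fun _ => Fin n).sum_comp, Fintype.sum_prod_type]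
      refine sum_congr rfl fun j _ => ?_
      rw [← sum_boole]
      refine sum_congr rfl fun t _ => ?_
      have : ∑ x with (∀ s, (Fin.consEquiv fun _ => Fin n) (j, t) s ∉ zeroSet x), w x =
          ∑ x with (∀ s, t s ∉ zeroSet x), v j x := by
        rw [sum_filter, sum_filter]
        refine sum_congr rfl fun x _ => ?_
        simp only [Fin.consEquiv, Equiv.coe_fn_mk, Fin.forall_fin_succ, Fin.cons_zero,
          Fin.cons_succ, hv]
        by_cases h1 : j ∈ zeroSet x <;> simp only [h1] <;> simp
      rw [this]
    rw [hrec]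
    set B := univ.filter fun j : Fin n => ∑ x with j ∈ zeroSet x, w x < F / (2 * b) with hB
    have hBcard : (#B : ℝ) ≤ n / 4 := card_rarely_zero_le hb hbn hw0 hw hW (hF.trans hθF)
    have hstep : ∀ j, (#(univ.filter fun t : Fin r → Fin n =>
        θ ≤ ∑ x with (∀ s, t s ∉ zeroSet x), v j x) : ℝ) ≤
          (n * (53 / 100)) ^ r * ((∑ x, v j x) / θ) ^ (2 * b) := by
      intro j
      by_cases hθv : ∑ x, v j x < θ
      · rw [filter_eq_empty_iff.2]
        · have := sum_nonneg fun x (_ : x ∈ univ) => hv0 j x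
          simp only [card_empty, Nat.cast_zero]
          positivity
        · intro t _ h
          refine absurd (h.trans (sum_le_sum_of_subset_of_nonneg (filter_subset _ _) ?_))
            hθv.not_ge
          exact fun x _ _ => hv0 j x
      · rw [not_lt] at hθv
        exact ih (v j) (hv0 j) (fun x => (hvw j x).trans (hw x)) hθv rfl (hθ.trans_le hθv)
    have hvF : ∀ j, ∑ x, v j x ≤ F := fun j => sum_le_sum fun x _ => hvw j x
    -- A coordinate with its fair share of zeros removes a fraction at least `1 / (2b)` of the mass,
    -- so the potential drops by a factor of about `1/e`.
    have hbase : ((1 - 1 / (2 * b)) : ℝ) ^ (2 * b) ≤ 37 / 100 := by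
      have h1 := Real.one_sub_le_exp_neg (1 / (2 * b) : ℝ)
      have hb1 : (1 : ℝ) ≤ b := by exact_mod_cast hb
      have h2 : (0 : ℝ) ≤ 1 - 1 / (2 * b) := by
        rw [sub_nonneg, div_le_one (by positivity)]; linarith
      calc _ ≤ (Real.exp (-(1 / (2 * b) : ℝ))) ^ (2 * b) := by gcongr
        _ = Real.exp (-1) := by
            rw [← Real.exp_nat_mul]
            congr 1
            push_cast
            field_simp
        _ ≤ _ := by linarith [Real.exp_neg_one_lt_d9]
    have hgood : ∀ j ∉ B, ((∑ x, v j x) / θ) ^ (2 * b) ≤ 37 / 100 * (F / θ) ^ (2 * b) := by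
      intro j hj
      have h1 : F / (2 * b) ≤ ∑ x with j ∈ zeroSet x, w x := by
        simpa [hB] using hj
      have h2 : ∑ x, v j x = F - ∑ x with j ∈ zeroSet x, w x := by
        rw [hFdef, sum_filter, ← sum_sub_distrib]
        refine sum_congr rfl fun x _ => ?_
        simp only [hv]; split_ifs <;> simp
      have h3 : (∑ x, v j x) / θ ≤ (1 - 1 / (2 * b)) * (F / θ) := by
        rw [← mul_div_assoc]
        gcongr
        rw [h2]
        calc _ ≤ F - F / (2 * b) := by linarith
          _ = _ := by ring
      calc _ ≤ ((1 - 1 / (2 * b)) * (F / θ)) ^ (2 * b) := by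
            have := sum_nonneg fun x (_ : x ∈ univ) => hv0 j x
            gcongr
        _ = (1 - 1 / (2 * b)) ^ (2 * b) * (F / θ) ^ (2 * b) := by rw [mul_pow]
        _ ≤ _ := by gcongr
    have hall : ∀ j, ((∑ x, v j x) / θ) ^ (2 * b) ≤
        (37 / 100 + if j ∈ B then 63 / 100 else 0) * (F / θ) ^ (2 * b) := by
      intro j
      have := sum_nonneg fun x (_ : x ∈ univ) => hv0 j x
      split_ifs with h
      · norm_num
        gcongr
        exact hvF j
      · simpa using hgood j h
    calc _ ≤ ∑ j, ((n * (53 / 100)) ^ r * ((37 / 100 + if j ∈ B then 63 / 100 else 0) *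
            (F / θ) ^ (2 * b)) : ℝ) := by
          refine sum_le_sum fun j _ => (hstep j).trans ?_
          gcongr
          exact hall j
      _ = (n * (53 / 100)) ^ r * ((37 / 100 * n + 63 / 100 * #B) * (F / θ) ^ (2 * b)) := by
          rw [← mul_sum, ← sum_mul, sum_add_distrib]
          simp [mul_comm]
      -- At most `n / 4` coordinates give no drop: `37/100 + (63/100) / 4 ≤ 53/100`.
      _ ≤ (n * (53 / 100)) ^ r * ((n * (53 / 100)) * (F / θ) ^ (2 * b)) := by
          gcongr
          linarith
      _ = _ := by ring

end SparseDisjointness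

/-! ### The corruption bound for rectangles. -/

namespace SparseDisjointness

open Finset

variable {n b : ℕ}

/-- The sparse subset of `Fin n` covered by a sequence. -/
def range (t : Fin b → Fin n) : Finset (Fin n) := univ.image t

lemma disjoint_zeroSet_range {x : Fin n → Fin b} {r : ℕ} {t : Fin r → Fin n} :
    Disjoint (zeroSet x) (range t) ↔ ∀ s, t s ∉ zeroSet x := by
  rw [disjoint_right]
  simp [range]

open Classical in
/-- On a rectangle, disjoint pairs are outnumbered by intersecting ones up to a small error. -/
lemma rectangle_disjoint_le {Ω : Type*} (hb : 128 ≤ b) (hbn : b ^ 2 ≤ n) (C : Finset Ω)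
    (X : Ω → Fin n → Fin b) (T : Ω → Fin b → Fin n)
    (hT : ∀ t, (#(C.filter fun ω => T ω = t) : ℝ) * n ^ b = #C)
    (A B : Finset Ω) (hA : A ⊆ C) (hB : B ⊆ C)
    (hX : ∀ x, (#(A.filter fun ω => X ω = x) : ℝ) * b ^ n ≤ Real.exp (b / 256) * #C) :
    (#((A ×ˢ B).filter fun p => Disjoint (zeroSet (X p.1)) (range (T p.2))) : ℝ) ≤
      9 * #((A ×ˢ B).filter fun p => ¬ Disjoint (zeroSet (X p.1)) (range (T p.2))) +
        (Real.exp (-(b / 256)) + (2 / 3) ^ b) * #C ^ 2 := by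
  have hb0 : 0 < b := by omega
  have hb' : (0 : ℝ) < b := by exact_mod_cast hb0
  have hn' : (0 : ℝ) < n := by
    exact_mod_cast (Nat.pow_pos hb0).trans_le hbn
  have hAC : (#A : ℝ) ≤ #C := by exact_mod_cast card_le_card hA
  have hBC : (#B : ℝ) ≤ #C := by exact_mod_cast card_le_card hB
  by_cases hsmall : (#A : ℝ) ≤ Real.exp (-(b / 256)) * #C
  · have h1 : (#((A ×ˢ B).filter fun p => Disjoint (zeroSet (X p.1)) (range (T p.2))) : ℝ) ≤
        #A * #B := by
      rw [← Nat.cast_mul, ← card_product]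
      exact_mod_cast card_filter_le _ _
    calc _ ≤ _ := h1
      _ ≤ Real.exp (-(b / 256)) * #C * #C := by gcongr
      _ = 0 + Real.exp (-(b / 256)) * #C ^ 2 := by ring
      _ ≤ _ := by
          gcongr
          · positivity
          · exact le_add_of_nonneg_right (by positivity)
  rw [not_le] at hsmall
  have hCpos : (0 : ℝ) < #C := by
    by_contra h
    have hC0 : (#C : ℝ) = 0 := le_antisymm (not_lt.1 h) (Nat.cast_nonneg _)
    rw [hC0] at hsmall hAC
    linarith
  have hApos : (0 : ℝ) < #A := lt_of_le_of_lt (by positivity) hsmall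
  set w : (Fin n → Fin b) → ℝ := fun x => #(A.filter fun ω => X ω = x) with hw
  set W : ℝ := Real.exp (b / 256) * #C / b ^ n with hW
  have hwW : ∀ x, w x ≤ W := fun x => by
    rw [hW, le_div_iff₀ (by positivity)]
    exact hX x
  have hsum : ∀ (P : (Fin n → Fin b) → Prop) [DecidablePred P],
      ∑ x with P x, w x = #(A.filter fun ω => P (X ω)) := by
    intro P _
    rw [card_eq_sum_card_fiberwise (f := X) (t := univ.filter P)]
    · rw [Nat.cast_sum]
      refine sum_congr rfl fun x hx => ?_
      simp only [hw, filter_filter]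
      congr 2
      ext ω
      simp only [mem_filter, mem_univ, true_and] at hx ⊢
      constructor
      · rintro ⟨h1, rfl⟩; exact ⟨h1, hx, rfl⟩
      · rintro ⟨h1, _, h3⟩; exact ⟨h1, h3⟩
    · intro ω hω
      simp at hω
      simp [hω.2]
  have hF : ∑ x, w x = #A := by
    have := hsum fun _ => True
    simpa using this
  -- A column with less than `9/10` of `A` disjoint from it has at most nine disjoint points per
  -- intersecting one.
  set θ : ℝ := 9 / 10 * #A with hθ
  -- Of the allowance `b / 64`, the density of `w` uses `b / 256`, the size of `A` another `b /
  -- 256`, and the remaining `b / 128 ≥ 1` covers the factor `9/10`.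
  have hexp : Real.exp (-(b / 64 : ℝ)) * (W * b ^ n) ≤ θ := by
    rw [hW, div_mul_cancel₀ _ (by positivity), ← mul_assoc, ← Real.exp_add]
    have h1 : (-(b / 64) + b / 256 : ℝ) = -(b / 128) + -(b / 256) := by ring
    have h2 : Real.exp (-(b / 128 : ℝ)) ≤ 9 / 10 := by
      have h3 : Real.exp (-(b / 128 : ℝ)) ≤ Real.exp (-1) := by
        rw [Real.exp_le_exp, neg_le_neg_iff, one_le_div (by norm_num)]
        exact_mod_cast hb
      linarith [Real.exp_neg_one_lt_d9]
    rw [h1, Real.exp_add, mul_assoc, hθ]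
    gcongr
  have hbad := card_avoiding_le hb0 hbn (W := W) (θ := θ) (by positivity) (by positivity) hexp b w
    (fun x => Nat.cast_nonneg _) hwW
  set bad : Finset (Fin b → Fin n) := univ.filter fun t =>
      θ ≤ ∑ x with (∀ s, t s ∉ zeroSet x), w x with hbadDef
  -- Here `F / θ = 10/9`, and `(53/100) * (10/9)² ≤ 2/3`.
  have hbad2 : (#bad : ℝ) ≤ n ^ b * (2 / 3) ^ b := by
    refine hbad.trans ?_
    rw [hF, hθ, pow_mul, mul_pow, mul_assoc, ← mul_pow]
    have : (#A : ℝ) / (9 / 10 * #A) = 10 / 9 := by field_simp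
    rw [this]
    gcongr
    norm_num
  have hBbad : (#(B.filter fun ω => T ω ∈ bad) : ℝ) ≤ #C * (2 / 3) ^ b := by
    have h1 : (#(B.filter fun ω => T ω ∈ bad) : ℝ) * n ^ b ≤ #bad * #C := by
      calc _ ≤ (#(C.filter fun ω => T ω ∈ bad) : ℝ) * n ^ b := by
            gcongr
        _ = ∑ t ∈ bad, (#(C.filter fun ω => T ω = t) : ℝ) * n ^ b := by
            rw [card_eq_sum_card_fiberwise (f := T) (t := bad), Nat.cast_sum, sum_mul]
            · refine sum_congr rfl fun t ht => ?_
              congr 3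
              ext ω
              simp only [mem_filter]
              constructor
              · rintro ⟨⟨h1, _⟩, h2⟩; exact ⟨h1, h2⟩
              · rintro ⟨h1, rfl⟩; exact ⟨⟨h1, ht⟩, rfl⟩
            · intro ω hω
              simp at hω
              simp [hω.2]
        _ = _ := by rw [sum_congr rfl fun t _ => hT t, sum_const, nsmul_eq_mul]
    have h2 : (#bad : ℝ) * #C ≤ n ^ b * (2 / 3) ^ b * #C := by gcongr
    have h3 := h1.trans h2
    refine le_of_mul_le_mul_right (h3.trans_eq ?_) (show (0 : ℝ) < n ^ b by positivity)
    ring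
  have hcol : ∀ ω' ∈ B, (#(A.filter fun ω => Disjoint (zeroSet (X ω)) (range (T ω'))) : ℝ) ≤
      9 * #(A.filter fun ω => ¬ Disjoint (zeroSet (X ω)) (range (T ω'))) +
        if T ω' ∈ bad then (#C : ℝ) else 0 := by
    intro ω' _
    have hadd : (#(A.filter fun ω => Disjoint (zeroSet (X ω)) (range (T ω'))) : ℝ) +
        #(A.filter fun ω => ¬ Disjoint (zeroSet (X ω)) (range (T ω'))) = #A := by
      rw [← Nat.cast_add, card_filter_add_card_filter_not]
    split_ifs with h
    · have : (0 : ℝ) ≤ #(A.filter fun ω => ¬ Disjoint (zeroSet (X ω)) (range (T ω'))) :=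
        Nat.cast_nonneg _
      linarith
    · have h2 : ∑ x with (∀ s, T ω' s ∉ zeroSet x), w x < θ := by
        simpa [hbadDef] using h
      rw [hsum fun x => ∀ s, T ω' s ∉ zeroSet x] at h2
      simp only [← disjoint_zeroSet_range] at h2
      rw [hθ] at h2
      linarith
  have hprod : ∀ (P : Ω → Ω → Prop) [∀ ω ω', Decidable (P ω ω')],
      (#((A ×ˢ B).filter fun p => P p.1 p.2) : ℝ) =
      ∑ ω' ∈ B, (#(A.filter fun ω => P ω ω') : ℝ) := by
    intro P _
    rw [card_filter, sum_product_right, Nat.cast_sum]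
    refine sum_congr rfl fun ω' _ => ?_
    rw [card_filter]
  rw [hprod fun ω ω' => Disjoint (zeroSet (X ω)) (range (T ω')),
    hprod fun ω ω' => ¬ Disjoint (zeroSet (X ω)) (range (T ω'))]
  refine (sum_le_sum hcol).trans ?_
  rw [sum_add_distrib, ← mul_sum, ← sum_filter, sum_const, nsmul_eq_mul]
  refine add_le_add le_rfl ?_
  calc _ ≤ #C * (2 / 3) ^ b * (#C : ℝ) := mul_le_mul_of_nonneg_right hBbad hCpos.le
    _ = 0 + (2 / 3) ^ b * #C ^ 2 := by ring
    _ ≤ _ := by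
      rw [add_mul]
      gcongr
      positivity

open Classical in
/-- A partition of the accepted pairs into few rectangles cannot accept many disjoint pairs without
accepting many intersecting ones. -/
lemma accepted_disjoint_le {Ω Λ : Type*} (hb : 128 ≤ b) (hbn : b ^ 2 ≤ n) (C D : Finset Ω)
    (hD : D ⊆ C) (X : Ω → Fin n → Fin b) (T : Ω → Fin b → Fin n)
    (hT : ∀ t, (#(C.filter fun ω => T ω = t) : ℝ) * n ^ b = #C)
    (hX : ∀ x, (#(D.filter fun ω => X ω = x) : ℝ) * b ^ n ≤ Real.exp (b / 256) * #C)
    (label : Ω → Ω → Λ) (acc : Ω → Ω → Prop) (R : Finset Λ)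
    (hR : ∀ ω ∈ C, ∀ ω' ∈ C, acc ω ω' → label ω ω' ∈ R)
    (hrect : ∀ ω₁ ∈ C, ∀ ω₁' ∈ C, ∀ ω₂ ∈ C, ∀ ω₂' ∈ C, label ω₁ ω₁' = label ω₂ ω₂' →
      acc ω₁ ω₁' → acc ω₂ ω₂' → label ω₁ ω₂' = label ω₁ ω₁' ∧ acc ω₁ ω₂') :
    (#((D ×ˢ C).filter fun p => acc p.1 p.2 ∧ Disjoint (zeroSet (X p.1)) (range (T p.2))) : ℝ) ≤
      9 * #((D ×ˢ C).filter fun p =>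
          acc p.1 p.2 ∧ ¬ Disjoint (zeroSet (X p.1)) (range (T p.2))) +
        #R * ((Real.exp (-(b / 256)) + (2 / 3) ^ b) * #C ^ 2) := by
  set A : Λ → Finset Ω := fun l => D.filter fun ω => ∃ ω' ∈ C, label ω ω' = l ∧ acc ω ω' with hA
  set B : Λ → Finset Ω := fun l => C.filter fun ω' => ∃ ω ∈ D, label ω ω' = l ∧ acc ω ω' with hB
  -- By `hrect`, the accepted pairs with label `l` are exactly the rectangle `A l × B l`.
  have hAB : ∀ l (ω ω' : Ω), (ω ∈ A l ∧ ω' ∈ B l) ↔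
      (ω ∈ D ∧ ω' ∈ C) ∧ acc ω ω' ∧ label ω ω' = l := by
    intro l ω ω'
    simp only [hA, hB, mem_filter]
    constructor
    · rintro ⟨⟨h1, ω₁', h2, rfl, h4⟩, h5, ω₂, h6, h7, h8⟩
      have := hrect ω (hD h1) ω₁' h2 ω₂ (hD h6) ω' h5 h7.symm h4 h8
      exact ⟨⟨h1, h5⟩, this.2, this.1⟩
    · rintro ⟨⟨h1, h2⟩, h3, h4⟩
      exact ⟨⟨h1, ω', h2, h4, h3⟩, h2, ω, h1, h4, h3⟩
  have hsplit : ∀ (P : Ω → Ω → Prop) [∀ ω ω', Decidable (P ω ω')],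
      (#((D ×ˢ C).filter fun p => acc p.1 p.2 ∧ P p.1 p.2) : ℝ) =
      ∑ l ∈ R, (#((A l ×ˢ B l).filter fun p => P p.1 p.2) : ℝ) := by
    intro P _
    rw [card_eq_sum_card_fiberwise (f := fun p : Ω × Ω => label p.1 p.2) (t := R), Nat.cast_sum]
    · refine sum_congr rfl fun l _ => ?_
      congr 2
      ext ⟨ω, ω'⟩
      have := hAB l ω ω'
      simp only [mem_filter, mem_product] at this ⊢
      rw [this]
      tauto
    · rintro ⟨ω, ω'⟩ h
      simp only [coe_filter, mem_product, Set.mem_ofPred_eq] at h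
      exact hR ω (hD h.1.1) ω' h.1.2 h.2.1
  rw [hsplit fun ω ω' => Disjoint (zeroSet (X ω)) (range (T ω')),
    hsplit fun ω ω' => ¬ Disjoint (zeroSet (X ω)) (range (T ω')), mul_sum, ← nsmul_eq_mul (#R),
    ← sum_const, ← sum_add_distrib]
  refine sum_le_sum fun l _ => ?_
  refine rectangle_disjoint_le hb hbn C X T hT (A l) (B l) ((filter_subset _ _).trans hD)
    (filter_subset _ _) fun x => le_trans ?_ (hX x)
  gcongr
  exact filter_subset _ _

/-- The previous bound summed row by row, with disjointness as an abstract relation, so that it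
matches averages over a fibre. -/
lemma sum_accepted_disjoint_le {Ω Λ : Type*} (hb : 128 ≤ b) (hbn : b ^ 2 ≤ n) (C D : Finset Ω)
    (hD : D ⊆ C) (X : Ω → Fin n → Fin b) (T : Ω → Fin b → Fin n)
    (hT : ∀ t, (#(C.filter fun ω => T ω = t) : ℝ) * n ^ b = #C)
    (hX : ∀ x, (#(D.filter fun ω => X ω = x) : ℝ) * b ^ n ≤ Real.exp (b / 256) * #C)
    (label : Ω → Ω → Λ) (acc dis : Ω → Ω → Prop) (R : Finset Λ)
    (hdis : ∀ ω ω', dis ω ω' ↔ Disjoint (zeroSet (X ω)) (range (T ω')))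
    (hR : ∀ ω ∈ C, ∀ ω' ∈ C, acc ω ω' → label ω ω' ∈ R)
    (hrect : ∀ ω₁ ∈ C, ∀ ω₁' ∈ C, ∀ ω₂ ∈ C, ∀ ω₂' ∈ C, label ω₁ ω₁' = label ω₂ ω₂' →
      acc ω₁ ω₁' → acc ω₂ ω₂' → label ω₁ ω₂' = label ω₁ ω₁' ∧ acc ω₁ ω₂')
    [∀ ω, DecidablePred fun ω' => acc ω ω' ∧ dis ω ω']
    [∀ ω, DecidablePred fun ω' => acc ω ω' ∧ ¬ dis ω ω'] :
    ∑ ω ∈ D, (#(C.filter fun ω' => acc ω ω' ∧ dis ω ω') : ℝ) ≤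
      9 * ∑ ω ∈ D, (#(C.filter fun ω' => acc ω ω' ∧ ¬ dis ω ω') : ℝ) +
        #R * ((Real.exp (-(b / 256)) + (2 / 3) ^ b) * #C ^ 2) := by
  classical
  have hprod : ∀ P : Ω → Ω → Prop, ∑ ω ∈ D, (#(C.filter fun ω' => P ω ω') : ℝ) =
      #((D ×ˢ C).filter fun p => P p.1 p.2) := by
    intro P
    rw [card_filter, sum_product, Nat.cast_sum]
    refine sum_congr rfl fun ω _ => ?_
    rw [card_filter]
  obtain rfl : dis = fun ω ω' => Disjoint (zeroSet (X ω)) (range (T ω')) := by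
    funext ω ω'
    exact propext (hdis ω ω')
  have key := accepted_disjoint_le hb hbn C D hD X T hT hX label acc R hR hrect
  have h1 := hprod fun ω ω' => acc ω ω' ∧ Disjoint (zeroSet (X ω)) (range (T ω'))
  have h2 := hprod fun ω ω' => acc ω ω' ∧ ¬ Disjoint (zeroSet (X ω)) (range (T ω'))
  convert key using 2
  · convert h1
  · congr 1
    convert h2

/-- At least a quarter of all pairs are disjoint. -/
lemma card_disjoint_ge (hb : 2 ≤ b) (t : Fin b → Fin n) :
    (b : ℝ) ^ n / 4 ≤ #(univ.filter fun x : Fin n → Fin b => Disjoint (zeroSet x) (range t)) := by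
  classical
  have hb0 : 0 < b := by omega
  have hb' : (0 : ℝ) < b := by exact_mod_cast hb0
  have h1 : (#(univ.filter fun x : Fin n → Fin b => Disjoint (zeroSet x) (range t)) : ℝ) =
      ∑ x : Fin n → Fin b, ∏ j, if j ∈ range t then (if (x j : ℕ) = 0 then (0 : ℝ) else 1) else 1 := by
    rw [← sum_boole]
    refine sum_congr rfl fun x _ => ?_
    rw [prod_ite_mem, univ_inter]
    split_ifs with h
    · rw [prod_eq_one]
      intro j hj
      rw [disjoint_right] at h
      have := h hj
      rw [mem_zeroSet] at this
      simp [this]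
    · rw [not_disjoint_iff] at h
      obtain ⟨j, hj, hj'⟩ := h
      exact (prod_eq_zero hj' (by simpa using hj)).symm
  rw [h1, ← Fintype.prod_sum (f := fun j (c : Fin b) =>
    if j ∈ range t then (if (c : ℕ) = 0 then (0 : ℝ) else 1) else 1)]
  have h2 : ∀ j : Fin n, (∑ c : Fin b,
      if j ∈ range t then (if (c : ℕ) = 0 then (0 : ℝ) else 1) else 1) =
        b * if j ∈ range t then (1 - 1 / b : ℝ) else 1 := by
    intro j
    split_ifs
    · rw [sum_fin_ite_zero hb0]; field_simp; ring
    · simp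
  rw [prod_congr rfl fun j _ => h2 j, prod_mul_distrib, prod_const, card_univ, Fintype.card_fin,
    prod_ite_mem, univ_inter, prod_const, div_eq_mul_one_div]
  gcongr
  have hq0 : (0 : ℝ) ≤ 1 - 1 / b := by
    rw [sub_nonneg, div_le_one hb']
    exact_mod_cast hb0
  have hq1 : (1 - 1 / b : ℝ) ≤ 1 := by
    have : (0 : ℝ) < 1 / b := by positivity
    linarith
  have hcard : #(range t) ≤ b := card_image_le.trans (by simp)
  refine le_trans ?_ (pow_le_pow_of_le_one hq0 hq1 hcard)
  have hb2 : (2 : ℝ) ≤ b := by exact_mod_cast hb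
  -- Bernoulli with the real exponent `b / 2` gives `(1 - 1/b) ^ (b/2) ≥ 1/2`; its square is the
  -- claim.
  have hbern := one_add_mul_self_le_rpow_one_add (s := -(1 / b : ℝ)) (by linarith)
    (p := b / 2) (by linarith)
  have hsq : ((1 + -(1 / b : ℝ)) ^ (b / 2 : ℝ)) ^ 2 = (1 - 1 / b) ^ b := by
    rw [← sub_eq_add_neg, ← Real.rpow_natCast, ← Real.rpow_mul hq0, ← Real.rpow_natCast]
    congr 1
    push_cast
    ring
  have hhalf : (1 + b / 2 * -(1 / b) : ℝ) = 1 / 2 := by field_simp; norm_num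
  rw [hhalf] at hbern
  rw [← hsq]
  nlinarith

end SparseDisjointness

/-! ### Finding an index on which the advice says little. -/

namespace FiniteEntropy

open Finset

variable {Ω ι α μ γ : Type*} [DecidableEq ι]

/-- The subfamily of the random variables `X` with indices in `J`. -/
def subfamily (X : ι → Ω → α) (J : Finset ι) (ω : Ω) (j : ι) : Option α :=
  if j ∈ J then some (X j ω) else none

lemma subfamily_eq_iff {X : ι → Ω → α} {J : Finset ι} {ω ω' : Ω} :
    subfamily X J ω' = subfamily X J ω ↔ ∀ j ∈ J, X j ω' = X j ω := by
  constructor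
  · intro h j hj
    simpa [subfamily, hj] using congrFun h j
  · intro h
    funext j
    by_cases hj : j ∈ J
    · simp [subfamily, hj, h j hj]
    · simp [subfamily, hj]

lemma subfamily_insert_eq_iff {X : ι → Ω → α} {J : Finset ι} {i : ι} {ω ω' : Ω} :
    subfamily X (insert i J) ω' = subfamily X (insert i J) ω ↔
      X i ω' = X i ω ∧ subfamily X J ω' = subfamily X J ω := by
  rw [subfamily_eq_iff, subfamily_eq_iff, forall_mem_insert]

variable [Fintype Ω] [Nonempty Ω]

lemma entropy_subfamily_le {X : ι → Ω → α} {c : ℝ} (hX : ∀ i, entropy (X i) ≤ c)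
    (J : Finset ι) : entropy (subfamily X J) ≤ #J * c := by
  induction J using Finset.induction_on with
  | empty =>
    refine (entropy_le_log (R := {fun _ => none}) fun ω => ?_).trans (by simp)
    rw [mem_singleton]
    funext j
    simp [subfamily]
  | insert i J hi ih =>
    have h1 : entropy (subfamily X (insert i J)) = entropy (fun ω => (X i ω, subfamily X J ω)) :=
      entropy_eq_of_iff fun ω ω' => by
        simp only [Prod.mk.injEq]; exact subfamily_insert_eq_iff
    have h2 := entropy_pair_le (X i) (subfamily X J)
    have h3 := hX i
    rw [card_insert_of_notMem hi]
    push_cast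
    linarith

/-- Conditional subadditivity, one application of submodularity per index. -/
lemma entropy_subfamily_cond_le (X : ι → Ω → α) (Z : Ω → γ) (A : Finset ι) :
    entropy (fun ω => (subfamily X A ω, Z ω)) - entropy Z ≤
      ∑ i ∈ A, (entropy (fun ω => (X i ω, Z ω)) - entropy Z) := by
  induction A using Finset.induction_on with
  | empty =>
    rw [sum_empty, sub_nonpos]
    exact entropy_mono fun ω ω' h => by
      simp only [Prod.mk.injEq, subfamily_eq_iff]
      exact ⟨by simp, h⟩
  | insert i A hi ih =>
    have h1 : entropy (fun ω => (subfamily X (insert i A) ω, Z ω)) =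
        entropy (fun ω => (X i ω, subfamily X A ω, Z ω)) :=
      entropy_eq_of_iff fun ω ω' => by
        simp only [Prod.mk.injEq, subfamily_insert_eq_iff, and_assoc]
    have h2 := entropy_submodular (X i) (subfamily X A) Z
    rw [sum_insert hi]
    linarith

variable [Fintype ι]

/-- Revealing few messages about a family of independent uniform variables leaves some other
variable almost uniform. -/
lemma exists_cond_entropy_ge {X : ι → Ω → α} {M : ι → Ω → μ} {h m : ℝ}
    (hX : ∀ i, entropy (X i) ≤ h) (hM : ∀ i, entropy (M i) ≤ m)
    (hind : Fintype.card ι * h ≤ entropy (fun ω i => X i ω)) (J : Finset ι)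
    (hJ : 2 * #J ≤ Fintype.card ι) (hJ' : #J < Fintype.card ι) :
    ∃ i ∉ J, h - m ≤ entropy (fun ω => (X i ω, subfamily (fun j ω => (X j ω, M j ω)) J ω)) -
      entropy (subfamily (fun j ω => (X j ω, M j ω)) J) := by
  set Z := subfamily (fun j ω => (X j ω, M j ω)) J with hZ
  by_contra! hcon
  have hm : 0 ≤ m := (entropy_nonneg _).trans (hM (Classical.choice (by
    rw [← Fintype.card_pos_iff]; omega)))
  have hcard : #Jᶜ + #J = Fintype.card ι := by
    rw [add_comm, card_add_card_compl]
  have hne : Jᶜ.Nonempty := card_pos.1 (by omega)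
  have h1 := entropy_subfamily_cond_le X Z Jᶜ
  have h2 : ∑ i ∈ Jᶜ, (entropy (fun ω => (X i ω, Z ω)) - entropy Z) < ∑ _i ∈ Jᶜ, (h - m) :=
    sum_lt_sum_of_nonempty hne fun i hi => hcon i (mem_compl.1 hi)
  rw [sum_const, nsmul_eq_mul] at h2
  have h3 : entropy Z ≤ #J * (h + m) := entropy_subfamily_le (fun i =>
    (entropy_pair_le (X i) (M i)).trans (add_le_add (hX i) (hM i))) J
  have h4 : entropy (fun ω i => X i ω) ≤ entropy (fun ω => (subfamily X Jᶜ ω, Z ω)) :=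
    entropy_mono fun ω ω' hω => by
      simp only [Prod.mk.injEq, subfamily_eq_iff, hZ, mem_compl] at hω
      funext i
      by_cases hi : i ∈ J
      · exact (hω.2 i hi).1
      · exact hω.1 i hi
  -- The messages in `J` carry at most `#J * m` of information. Since `#J ≤ #Jᶜ`, this is at most
  -- `m` per remaining index on average.
  have h5 : (#J : ℝ) * m ≤ #Jᶜ * m := by
    exact mul_le_mul_of_nonneg_right (by exact_mod_cast (by omega : #J ≤ #Jᶜ)) hm
  have h6 : (#Jᶜ : ℝ) + #J = Fintype.card ι := by exact_mod_cast hcard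
  rw [← h6] at hind
  linarith

/-- If `Y` has little information about a family of independent uniform variables `X`, then some
`X i` stays almost independent of `Y` and almost uniform, even given the short message `M i` and a
suitable part `V` of the rest of the family. -/
lemma exists_almost_independent {X : ι → Ω → α} {M : ι → Ω → μ} {Y : Ω → γ} {h m u ε : ℝ}
    (hX : ∀ i, entropy (X i) ≤ h) (hM : ∀ i, entropy (M i) ≤ m)
    (hind : Fintype.card ι * h ≤ entropy (fun ω i => X i ω))
    (hMX : ∀ i ω ω', (∀ j, X j ω' = X j ω) → M i ω' = M i ω)
    (hY : entropy (fun ω i => X i ω) + entropy Y - entropy (fun ω => ((fun i => X i ω), Y ω)) ≤ u)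
    {r : ℕ} (hr : 2 * r ≤ Fintype.card ι) (hu : u < ε * r) :
    ∃ (i : ι) (V : Ω → (ι → Option (α × μ)) × μ),
      (∀ ω ω', V ω' = V ω → M i ω' = M i ω) ∧
      (∀ ω ω', (∀ j, X j ω' = X j ω) → V ω' = V ω) ∧
      entropy (fun ω => (X i ω, V ω)) + entropy (fun ω => (Y ω, V ω)) -
        entropy (fun ω => (X i ω, Y ω, V ω)) - entropy V ≤ ε ∧
      h + entropy V - entropy (fun ω => (X i ω, V ω)) ≤ 2 * m := by
  set Z : Finset ι → Ω → ι → Option (α × μ) := fun J => subfamily (fun j ω => (X j ω, M j ω)) J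
    with hZ
  have hZX : ∀ J ω ω', (∀ j, X j ω' = X j ω) → Z J ω' = Z J ω := by
    intro J ω ω' hω
    simp only [hZ, subfamily_eq_iff, Prod.mk.injEq]
    exact fun j _ => ⟨hω j, hMX j _ _ hω⟩
  by_contra! hcon
  -- If the gain were at most `ε`, then `V = (Z J, M i)` would contradict `hcon`. Moving `M i` into
  -- the condition does not raise the information above `I(X i, M i ; Y | Z J)`, and costs `X i` at
  -- most another `m` of entropy, whence `2 * m`.
  have hstep : ∀ i J, h - m ≤ entropy (fun ω => (X i ω, Z J ω)) - entropy (Z J) →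
      ε < entropy (fun ω => ((X i ω, M i ω), Z J ω)) + entropy (fun ω => (Y ω, Z J ω)) -
        entropy (fun ω => ((X i ω, M i ω), Y ω, Z J ω)) - entropy (Z J) := by
    intro i J hi
    by_contra! hle
    have e1 : entropy (fun ω => ((X i ω, M i ω), Z J ω)) =
        entropy (fun ω => (X i ω, Z J ω, M i ω)) := entropy_eq_of_iff (by simp; tauto)
    have e2 : entropy (fun ω => ((X i ω, M i ω), Y ω, Z J ω)) =
        entropy (fun ω => (X i ω, Y ω, Z J ω, M i ω)) := entropy_eq_of_iff (by simp; tauto)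
    have e3 : entropy (fun ω => (Y ω, M i ω, Z J ω)) =
        entropy (fun ω => (Y ω, Z J ω, M i ω)) := entropy_eq_of_iff (by simp; tauto)
    have e4 : entropy (fun ω => (M i ω, Z J ω)) =
        entropy (fun ω => (Z J ω, M i ω)) := entropy_eq_of_iff (by simp; tauto)
    have s1 := entropy_submodular Y (M i) (Z J)
    have s2 := entropy_pair_le (Z J) (M i)
    have s3 := hM i
    have s4 : entropy (fun ω => (X i ω, Z J ω)) ≤ entropy (fun ω => (X i ω, Z J ω, M i ω)) :=
      entropy_mono (by simp; tauto)
    refine (hcon i (fun ω => (Z J ω, M i ω)) ?_ ?_ ?_).not_ge ?_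
    · simp
    · intro ω ω' hω
      simp only [Prod.mk.injEq]
      exact ⟨hZX J _ _ hω, hMX i _ _ hω⟩
    · linarith
    · linarith
  -- The gains add up by the chain rule for `I(Z J ; Y)`.
  have hgrow : ∀ s, s ≤ r → ∃ J : Finset ι, #J = s ∧
      ε * s ≤ entropy (Z J) + entropy Y - entropy (fun ω => (Y ω, Z J ω)) := by
    intro s
    induction s with
    | zero =>
      intro _
      refine ⟨∅, rfl, ?_⟩
      have := entropy_pair_le Y (Z ∅)
      push_cast
      linarith
    | succ s ih =>
      intro hs
      obtain ⟨J, hJs, hJ⟩ := ih (by omega)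
      obtain ⟨i, hiJ, hi⟩ := exists_cond_entropy_ge hX hM hind J (by omega) (by omega)
      refine ⟨insert i J, by rw [card_insert_of_notMem hiJ, hJs], ?_⟩
      have h1 := hstep i J hi
      have e1 : entropy (Z (insert i J)) = entropy (fun ω => ((X i ω, M i ω), Z J ω)) :=
        entropy_eq_of_iff fun ω ω' => by
          simp only [hZ, subfamily_insert_eq_iff, Prod.mk.injEq]
      have e2 : entropy (fun ω => (Y ω, Z (insert i J) ω)) =
          entropy (fun ω => ((X i ω, M i ω), Y ω, Z J ω)) :=
        entropy_eq_of_iff fun ω ω' => by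
          simp only [hZ, subfamily_insert_eq_iff, Prod.mk.injEq]
          tauto
      rw [e1, e2]
      push_cast
      linarith
  obtain ⟨J, _, hJ⟩ := hgrow r le_rfl
  -- Data processing: `Z J` is a function of the family `X`, so `I(Z J ; Y) ≤ I(X ; Y) ≤ u < ε * r`.
  have s := entropy_submodular (fun ω i => X i ω) Y (Z J)
  have e1 : entropy (fun ω => ((fun i => X i ω), Y ω, Z J ω)) =
      entropy (fun ω => ((fun i => X i ω), Y ω)) := entropy_eq_of_iff fun ω ω' => by
    simp only [Prod.mk.injEq]
    exact ⟨fun h => ⟨h.1, h.2.1⟩, fun h => ⟨h.1, h.2, hZX J _ _ (congrFun h.1)⟩⟩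
  have e2 : entropy (fun ω => ((fun i => X i ω), Z J ω)) = entropy (fun ω i => X i ω) :=
    entropy_eq_of_iff fun ω ω' => by
      simp only [Prod.mk.injEq]
      exact ⟨fun h => h.1, fun h => ⟨h, hZX J _ _ (congrFun h)⟩⟩
  linarith

end FiniteEntropy

/-! ### Rectangles and the number of transcripts. -/

namespace TwoParty

/-- The inputs that lead to a given transcript and a given answer form a rectangle. -/
lemma transcript_answer_rectangle {A B : Type} (p : TwoParty A B) {a a' : A} {b b' : B}
    (ht : p.transcript a b = p.transcript a' b') (ha : p.answer a b = p.answer a' b') :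
    p.transcript a b' = p.transcript a b ∧ p.answer a b' = p.answer a b := by
  induction p with
  | aliceAnswers f => simp [transcript, answer]
  -- The announced answer is not in the transcript, so the agreement of answers has to be assumed;
  -- this is where it enters.
  | bobAnswers g => simpa [transcript, answer] using ha.symm
  | aliceSpeaks f next ih =>
    simp only [transcript, answer, List.cons.injEq] at ht ha ⊢
    obtain ⟨h1, h2⟩ := ht
    rw [← h1] at h2 ha
    simpa using ih _ h2 ha
  | bobSpeaks g next ih =>
    simp only [transcript, answer, List.cons.injEq] at ht ha ⊢
    obtain ⟨h1, h2⟩ := ht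
    rw [← h1] at h2 ha ⊢
    simpa using ih _ h2 ha

end TwoParty

/-- All bit strings of length at most `L`. -/
def shortBitStrings : ℕ → Finset (List Bool)
  | 0 => {[]}
  | L + 1 => insert [] ((shortBitStrings L).image (List.cons true) ∪
      (shortBitStrings L).image (List.cons false))

lemma mem_shortBitStrings {L : ℕ} {l : List Bool} (h : l.length ≤ L) : l ∈ shortBitStrings L := by
  induction L generalizing l with
  | zero =>
    have : l = [] := List.length_eq_zero_iff.1 (Nat.le_zero.1 h)
    simp [shortBitStrings, this]
  | succ L ih =>
    cases l with
    | nil => simp [shortBitStrings]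
    | cons x l =>
      have := ih (Nat.le_of_succ_le_succ h)
      cases x <;> simp [shortBitStrings, this]

lemma card_shortBitStrings_le (L : ℕ) : (shortBitStrings L).card ≤ 2 ^ (L + 1) := by
  -- The exact count is `2 ^ (L + 1) - 1`; the `+ 1` carries the induction past the empty string.
  have : (shortBitStrings L).card + 1 ≤ 2 ^ (L + 1) := by
    induction L with
    | zero => simp [shortBitStrings]
    | succ L ih =>
      have h1 := Finset.card_insert_le ([] : List Bool) ((shortBitStrings L).image (List.cons true) ∪
        (shortBitStrings L).image (List.cons false))
      have h2 := Finset.card_union_le ((shortBitStrings L).image (List.cons true))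
        ((shortBitStrings L).image (List.cons false))
      have h3 : ((shortBitStrings L).image (List.cons true)).card ≤ _ := Finset.card_image_le
      have h4 : ((shortBitStrings L).image (List.cons false)).card ≤ _ := Finset.card_image_le
      rw [shortBitStrings, pow_succ]
      omega
  omega

/-! ### Fibrewise sums and counting on product spaces. -/

namespace FiniteEntropy

open Finset

variable {Ω α γ : Type*} [Fintype Ω]

/-- Reduces an averaged inequality to one fibre of `V`, on which the broadcast is constant. -/
lemma sum_le_sum_of_fiber (V : Ω → γ) {f g : Ω → ℝ}
    (h : ∀ ω₀, ∑ ω ∈ fiber V ω₀, f ω ≤ ∑ ω ∈ fiber V ω₀, g ω) : ∑ ω, f ω ≤ ∑ ω, g ω := by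
  classical
  rw [← sum_fiberwise_of_maps_to (s := univ) (t := univ.image V) (g := V) (f := f) (by simp),
    ← sum_fiberwise_of_maps_to (s := univ) (t := univ.image V) (g := V) (f := g) (by simp)]
  refine sum_le_sum fun v hv => ?_
  obtain ⟨ω₀, _, rfl⟩ := mem_image.1 hv
  have : univ.filter (fun ω => V ω = V ω₀) = fiber V ω₀ := by ext; simp
  rw [this]
  exact h ω₀

lemma entropy_bits_le [Nonempty Ω] {M : Ω → List Bool} {L : ℕ} (h : ∀ ω, (M ω).length ≤ L) :
    entropy M ≤ (L + 1) * Real.log 2 := by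
  have hmem : ∀ ω, M ω ∈ shortBitStrings L := fun ω => mem_shortBitStrings (h ω)
  refine (entropy_le_log hmem).trans ?_
  have h1 : (#(shortBitStrings L) : ℝ) ≤ 2 ^ (L + 1) := by
    exact_mod_cast card_shortBitStrings_le L
  have h0 : (0 : ℝ) < #(shortBitStrings L) := by
    exact_mod_cast card_pos.2 ⟨_, hmem (Classical.arbitrary Ω)⟩
  refine (Real.log_le_log h0 h1).trans_eq ?_
  rw [Real.log_pow]
  push_cast
  ring

/-- On a product space, an event about the second factor is independent of the first one. -/
lemma card_fiber_filter_snd {α β : Type*} [Fintype α] [Fintype β] {V : α × β → γ}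
    (hV : ∀ ω ω' : α × β, ω'.1 = ω.1 → V ω' = V ω) (ω : α × β) (P : β → Prop) [DecidablePred P] :
    #((fiber V ω).filter fun ω' => P ω'.2) * Fintype.card β =
      #(fiber V ω) * #(univ.filter P) := by
  classical
  have h1 : fiber V ω = (univ.filter fun a => V (a, ω.2) = V ω) ×ˢ univ := by
    ext ω'
    simp only [mem_fiber, mem_product, mem_filter, mem_univ, true_and, and_true]
    rw [hV (ω'.1, ω.2) ω' rfl]
  have h2 : (fiber V ω).filter (fun ω' => P ω'.2) =
      (univ.filter fun a => V (a, ω.2) = V ω) ×ˢ univ.filter P := by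
    rw [h1]; ext ω'; simp
  rw [h2, h1, card_product, card_product, card_univ]
  ring

lemma card_filter_eval {κ : Type*} [Fintype κ] [DecidableEq κ] [Fintype α] (i : κ) (P : α → Prop)
    [DecidablePred P] :
    #(univ.filter fun s : κ → α => P (s i)) * Fintype.card α =
      Fintype.card α ^ Fintype.card κ * #(univ.filter P) := by
  classical
  have h : (univ.filter fun s : κ → α => P (s i)) =
      Fintype.piFinset (Function.update (fun _ => univ) i (univ.filter P)) := by
    ext s
    simp only [mem_filter, mem_univ, true_and, Fintype.mem_piFinset]
    constructor
    · intro h j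
      by_cases hj : j = i
      · subst hj; simpa using h
      · simp [hj]
    · intro h
      simpa using h i
  rw [h, Fintype.card_piFinset, Fintype.prod_eq_mul_prod_compl i]
  have h2 : ∀ j ∈ ({i}ᶜ : Finset κ),
      #(Function.update (fun _ => (univ : Finset α)) i (univ.filter P) j) = Fintype.card α := by
    intro j hj
    rw [mem_compl, mem_singleton] at hj
    simp [hj]
  rw [prod_congr rfl h2, prod_const, card_compl, card_singleton, Function.update_self, mul_assoc,
    ← pow_succ, mul_comm, Nat.sub_add_cancel (Fintype.card_pos_iff.2 ⟨i⟩)]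

end FiniteEntropy

/-! ### From the four-party protocol to a numerical constraint. -/

namespace FourParty

open Finset FiniteEntropy SparseDisjointness

variable {n k : ℕ}

lemma length_advice_le {Γ : FourParty n k} {u : ℕ} (h : Γ.adviceLength ≤ u)
    (S : Fin k → Finset (Fin n)) (T : Finset (Fin n)) : (Γ.advice S T).length ≤ u :=
  (le_sup (f := fun x : (Fin k → Finset (Fin n)) × Finset (Fin n) =>
    (Γ.advice x.1 x.2).length) (mem_univ (S, T))).trans h

lemma length_transcript_le {Γ : FourParty n k} {L : ℕ} {i : Fin k} (h : Γ.length i ≤ L)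
    (S : Fin k → Finset (Fin n)) (T : Finset (Fin n)) :
    (Γ.transcript i S T).1.length + (Γ.transcript i S T).2.length ≤ L :=
  (le_sup (f := fun x : (Fin k → Finset (Fin n)) × Finset (Fin n) =>
    (Γ.transcript i x.1 x.2).1.length + (Γ.transcript i x.1 x.2).2.length)
      (mem_univ (S, T))).trans h

/-- The hard distribution: `k` independent sparse sets, and an independent sparse set. -/
abbrev Sample (n k b : ℕ) : Type := (Fin k → Fin n → Fin b) × (Fin b → Fin n)

/-- Alice's view and Bob's view of a short protocol on the hard distribution, decoupled. -/
theorem exists_decoupled {b L u r : ℕ} (hb : 0 < b) (hn : 0 < n) {Γ : FourParty n k}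
    (hu : Γ.adviceLength ≤ u) (hL : ∀ i, Γ.length i ≤ L) (hr : 2 * r ≤ k) {ε : ℝ}
    (hur : (u + 1) * Real.log 2 < ε * r) :
    ∃ (i : Fin k) (V : Sample n k b →
        (Fin k → Option ((Fin n → Fin b) × List Bool)) × List Bool),
      (∀ ω ω', V ω' = V ω → Γ.broadcast (fun j => zeroSet (ω'.1 j)) i =
        Γ.broadcast (fun j => zeroSet (ω.1 j)) i) ∧
      (∀ ω ω', ω'.1 = ω.1 → V ω' = V ω) ∧
      entropy (fun ω => (ω.1 i, V ω)) + entropy (fun ω : Sample n k b =>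
          ((ω.2, Γ.advice (fun j => zeroSet (ω.1 j)) (range ω.2)), V ω)) -
        entropy (fun ω : Sample n k b =>
          (ω.1 i, (ω.2, Γ.advice (fun j => zeroSet (ω.1 j)) (range ω.2)), V ω)) -
        entropy V ≤ ε ∧
      Real.log (Fintype.card (Fin n → Fin b)) + entropy V - entropy (fun ω => (ω.1 i, V ω)) ≤
        2 * ((L + 1) * Real.log 2) := by
  have : Nonempty (Fin b) := ⟨⟨0, hb⟩⟩
  have : Nonempty (Fin n) := ⟨⟨0, hn⟩⟩
  have hS : entropy (fun ω : Sample n k b => ω.1) ≤ k * Real.log (Fintype.card (Fin n → Fin b)) := by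
    refine (entropy_le_log_card _).trans_eq ?_
    rw [Fintype.card_fun, Nat.cast_pow, Real.log_pow, Fintype.card_fin k]
  have hT := entropy_le_log_card (fun ω : Sample n k b => ω.2)
  have hΩ : entropy (fun ω : Sample n k b => (ω.1, ω.2)) =
      k * Real.log (Fintype.card (Fin n → Fin b)) + Real.log (Fintype.card (Fin b → Fin n)) := by
    rw [entropy_of_injective (fun ω ω' h => h), Fintype.card_prod, Nat.cast_mul,
      Real.log_mul (by exact_mod_cast Fintype.card_pos.ne') (by exact_mod_cast Fintype.card_pos.ne'),
      Fintype.card_fun, Nat.cast_pow, Real.log_pow, Fintype.card_fin k]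
  have hST := entropy_pair_le (fun ω : Sample n k b => ω.1) (fun ω : Sample n k b => ω.2)
  set U : Sample n k b → List Bool :=
    fun ω => Γ.advice (fun j => zeroSet (ω.1 j)) (range ω.2) with hU
  have hUe : entropy U ≤ (u + 1) * Real.log 2 :=
    entropy_bits_le fun ω => length_advice_le hu _ _
  have hTU := entropy_pair_le (fun ω : Sample n k b => ω.2) U
  -- As `S` and `T` are independent, `I(S ; (T, U)) ≤ H(U)`: `H(T, U) ≤ H(T) + H(U)` and `H(S, T, U)
  -- ≥ H(S) + H(T)`.
  have hSTU : entropy (fun ω : Sample n k b => (ω.1, ω.2)) ≤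
      entropy (fun ω : Sample n k b => (ω.1, (ω.2, U ω))) := entropy_mono (by simp)
  obtain ⟨i, V, h1, h2, h3, h4⟩ := exists_almost_independent
    (X := fun (i : Fin k) (ω : Sample n k b) => ω.1 i)
    (M := fun i (ω : Sample n k b) => Γ.broadcast (fun j => zeroSet (ω.1 j)) i)
    (Y := fun ω : Sample n k b => (ω.2, U ω))
    (h := Real.log (Fintype.card (Fin n → Fin b))) (m := (L + 1) * Real.log 2)
    (u := (u + 1) * Real.log 2) (ε := ε) (r := r)
    (fun i => entropy_le_log_card _)
    (fun i => entropy_bits_le fun ω => le_of_add_le_left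
      (length_transcript_le (hL i) (fun j => zeroSet (ω.1 j)) (range ω.2)))
    (by rw [Fintype.card_fin]; linarith)
    (fun i ω ω' h => by simp only [h])
    (by linarith) (by rwa [Fintype.card_fin]) hur
  exact ⟨i, V, h1, fun ω ω' h => h2 ω ω' (congrFun h), h3, h4⟩

lemma card_fiber_filter_snd_real {γ : Type*} {b : ℕ} {V : Sample n k b → γ}
    (hV : ∀ ω ω', ω'.1 = ω.1 → V ω' = V ω) (ω : Sample n k b) (P : (Fin b → Fin n) → Prop)
    [DecidablePred P] :
    (#((fiber V ω).filter fun ω' => P ω'.2) : ℝ) * n ^ b = #(fiber V ω) * #(univ.filter P) := by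
  have := card_fiber_filter_snd hV ω P
  rw [Fintype.card_fun, Fintype.card_fin, Fintype.card_fin] at this
  exact_mod_cast this

/-- If the pair of sets is resampled given the value of a function of the `k` sets, it is disjoint
with probability at least a quarter. -/
lemma card_disjoint_resampled_ge {γ : Type*} {b : ℕ} (hb : 2 ≤ b) (hn : 0 < n) (i : Fin k)
    {V : Sample n k b → γ} (hVS : ∀ ω ω', ω'.1 = ω.1 → V ω' = V ω)
    {dis : Sample n k b → Sample n k b → Prop} [∀ ω, DecidablePred fun ω' => dis ω ω']
    (hdis : ∀ ω ω', dis ω ω' ↔ Disjoint (zeroSet (ω.1 i)) (range ω'.2)) :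
    (Fintype.card (Sample n k b) : ℝ) / 4 ≤
      ∑ ω, (#((fiber V ω).filter fun ω' => dis ω ω') : ℝ) / #(fiber V ω) := by
  have hb' : (0 : ℝ) < b := by exact_mod_cast (show 0 < b by omega)
  have hn' : (0 : ℝ) < n := by exact_mod_cast hn
  have h1 : ∀ ω, (#((fiber V ω).filter fun ω' => dis ω ω') : ℝ) / #(fiber V ω) =
      (∑ t : Fin b → Fin n, if Disjoint (zeroSet (ω.1 i)) (range t) then (1 : ℝ) else 0) /
        n ^ b := by
    intro ω
    have := card_fiber_filter_snd_real hVS ω fun t => Disjoint (zeroSet (ω.1 i)) (range t)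
    have hcongr : (fiber V ω).filter (fun ω' => dis ω ω') =
        (fiber V ω).filter fun ω' => Disjoint (zeroSet (ω.1 i)) (range ω'.2) := by
      ext ω'; simp [hdis]
    rw [hcongr]
    rw [sum_boole, div_eq_div_iff (fiber_card_pos V ω).ne' (by positivity), mul_comm _ (#(fiber V ω) : ℝ)]
    exact this
  rw [sum_congr rfl fun ω _ => h1 ω, ← sum_div, sum_comm, le_div_iff₀ (by positivity)]
  have h2 : ∀ t : Fin b → Fin n, (Fintype.card (Sample n k b) : ℝ) / 4 ≤
      ∑ ω : Sample n k b, if Disjoint (zeroSet (ω.1 i)) (range t) then (1 : ℝ) else 0 := by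
    intro t
    have h3 := card_disjoint_ge (n := n) (b := b) (by omega) t
    have h4 := card_filter_eval (κ := Fin k) i
      fun x : Fin n → Fin b => Disjoint (zeroSet x) (range t)
    have h5 : ((#(univ.filter fun s : Fin k → Fin n → Fin b =>
        Disjoint (zeroSet (s i)) (range t)) : ℝ)) * b ^ n = (b ^ n) ^ k *
        #(univ.filter fun x : Fin n → Fin b => Disjoint (zeroSet x) (range t)) := by
      simp only [Fintype.card_fun, Fintype.card_fin] at h4
      exact_mod_cast h4
    have h6 : (Fintype.card (Sample n k b) : ℝ) = (b ^ n) ^ k * n ^ b := by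
      simp [Fintype.card_prod]
    have h7 : (b ^ n : ℝ) ^ k / 4 ≤ #(univ.filter fun s : Fin k → Fin n → Fin b =>
        Disjoint (zeroSet (s i)) (range t)) := by
      refine le_of_mul_le_mul_right ?_ (show (0 : ℝ) < b ^ n by positivity)
      rw [h5]
      calc _ = (b ^ n : ℝ) ^ k * (b ^ n / 4) := by ring
        _ ≤ _ := by gcongr
    rw [Fintype.sum_prod_type, sum_comm]
    simp only [sum_boole, sum_const, card_univ, nsmul_eq_mul, Fintype.card_fun, Fintype.card_fin]
    rw [h6]
    push_cast
    calc _ = (n : ℝ) ^ b * ((b ^ n) ^ k / 4) := by ring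
      _ ≤ _ := by gcongr
  calc _ = ∑ t : Fin b → Fin n, (Fintype.card (Sample n k b) : ℝ) / 4 := by
        simp [mul_comm]
    _ ≤ _ := sum_le_sum fun t _ => h2 t

set_option maxHeartbeats 1000000 in
open Classical in
/-- A numerical constraint that every protocol for the Multiphase game obeys. -/
theorem quarter_le_of_solvesDisj {b L u r : ℕ} (hb : 128 ≤ b) (hbn : b ^ 2 ≤ n)
    {Γ : FourParty n k} (hΓ : Γ.SolvesDisj) (hu : Γ.adviceLength ≤ u) (hL : ∀ i, Γ.length i ≤ L)
    (hr : 2 * r ≤ k) {ε : ℝ} (hur : (u + 1) * Real.log 2 < ε * r) :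
    1 / 4 ≤ 10 * ε + 2 ^ (L + 1) * (Real.exp (-(b / 256)) + (2 / 3) ^ b) +
      (2 * ((L + 1) * Real.log 2) + 1) / (b / 256) := by
  have hb0 : 0 < b := by omega
  have hb' : (0 : ℝ) < b := by exact_mod_cast hb0
  have hn0 : 0 < n := (Nat.pow_pos hb0).trans_le hbn
  have hn' : (0 : ℝ) < n := by exact_mod_cast hn0
  have : Nonempty (Fin b) := ⟨⟨0, hb0⟩⟩
  have : Nonempty (Fin n) := ⟨⟨0, hn0⟩⟩
  obtain ⟨i, V, hVM, hVS, hI, hlaw⟩ := exists_decoupled hb0 hn0 hu hL hr hur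
  set N : ℝ := ((Fintype.card (Sample n k b) : ℕ) : ℝ) with hN
  have hNpos : 0 < N := card_space_pos
  set U : Sample n k b → List Bool := fun ω => Γ.advice (fun j => zeroSet (ω.1 j)) (range ω.2) with hU
  set M : Sample n k b → List Bool := fun ω => Γ.broadcast (fun j => zeroSet (ω.1 j)) i with hM
  set d : Sample n k b → ℝ := fun ω => #(fiber V ω) with hd
  have dp : ∀ ω, 0 < d ω := fun ω => fiber_card_pos _ ω
  set label : Sample n k b → Sample n k b → List Bool := fun ω ω' =>
    (Γ.talk i (M ω)).transcript (zeroSet (ω.1 i)) (range ω'.2, U ω') with hlabel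
  -- A pair that cannot occur may have a transcript longer than `L`. Counting it as rejected keeps
  -- the number of labels below `2 ^ (L + 1)`.
  set acc : Sample n k b → Sample n k b → Prop := fun ω ω' =>
    (Γ.talk i (M ω)).answer (zeroSet (ω.1 i)) (range ω'.2, U ω') = true ∧
      (label ω ω').length ≤ L with hacc
  set dis : Sample n k b → Sample n k b → Prop := fun ω ω' => Disjoint (zeroSet (ω.1 i)) (range ω'.2) with hdis
  -- Pairs on which the protocol errs are rare.
  set wrong : Sample n k b → ℝ := fun ω => #((fiber V ω).filter fun ω' => ¬ (acc ω ω' ↔ dis ω ω')) with hwrong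
  -- A point `ω''` with Alice's input of `ω`, Bob's input of `ω'` and the same `V` runs the same
  -- conversation, and there zero error and the length bound apply.
  have hsupp : ∀ ω ω', (∃ ω'' : Sample n k b, ω''.1 i = ω.1 i ∧ (ω''.2, U ω'') = (ω'.2, U ω') ∧
      V ω'' = V ω) → (acc ω ω' ↔ dis ω ω') := by
    rintro ω ω' ⟨ω'', h1, h2, h3⟩
    have h4 : M ω'' = M ω := hVM _ _ h3
    have h5 := hΓ i (fun j => zeroSet (ω''.1 j)) (range ω''.2)
    have h6 := length_transcript_le (hL i) (fun j => zeroSet (ω''.1 j)) (range ω''.2)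
    simp only [Prod.mk.injEq] at h2
    have h7 : label ω ω' =
        (Γ.transcript i (fun j => zeroSet (ω''.1 j)) (range ω''.2)).2 := by
      simp only [hlabel, transcript]
      rw [← h4, ← h1, ← h2.1, ← h2.2]
    have h8 : (Γ.talk i (M ω)).answer (zeroSet (ω.1 i)) (range ω'.2, U ω') =
        disj (zeroSet (ω''.1 i)) (range ω''.2) := by
      rw [← h5, answer, ← h4, ← h1, ← h2.1, ← h2.2]
    simp only [hacc, hdis]
    rw [h7, h8, disj, decide_eq_true_iff, h1, h2.1]
    rw [h2.1] at h6
    exact ⟨fun h => h.1, fun h => ⟨h, by omega⟩⟩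
  have hwrong_sum : ∑ ω, wrong ω / d ω ≤ N * ε := by
    refine (sum_le_of_unsupported (fun ω : Sample n k b => ω.1 i)
      (fun ω : Sample n k b => (ω.2, U ω)) V fun ω ω' h ω'' h1 h2 h3 => ?_).trans
        (mul_le_mul_of_nonneg_left hI hNpos.le)
    exact h (hsupp ω ω' ⟨ω'', h1, h2, h3⟩)
  -- Points with a dense law.
  set D : Finset (Sample n k b) := univ.filter fun ω =>
    (#(fiber (fun ω => (ω.1 i, V ω)) ω) * Fintype.card (Fin n → Fin b) : ℝ) ≤
      Real.exp (b / 256) * #(fiber V ω) with hD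
  have hDc : (#Dᶜ : ℝ) ≤ N * ((2 * ((L + 1) * Real.log 2) + 1) / (b / 256)) := by
    have h := card_dense_le (fun ω : Sample n k b => ω.1 i) V (b / 256 : ℝ)
    have h1 : N * (Real.log (Fintype.card (Fin n → Fin b)) + entropy V -
        entropy (fun ω => (ω.1 i, V ω)) + 1) ≤ N * (2 * ((L + 1) * Real.log 2) + 1) := by
      gcongr
    rw [← mul_div_assoc, le_div_iff₀ (by positivity), mul_comm, hD, compl_filter]
    exact h.trans h1
  set η : ℝ := 2 ^ (L + 1) * (Real.exp (-(b / 256)) + (2 / 3) ^ b) with hη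
  set good : Sample n k b → ℝ := fun ω =>
    if ω ∈ D then (#((fiber V ω).filter fun ω' => acc ω ω' ∧ dis ω ω') : ℝ) / d ω else 0 with hgood
  have hgood_sum : ∑ ω, good ω ≤ ∑ ω, (9 * (wrong ω / d ω) + η) := by
    refine sum_le_sum_of_fiber V fun ω₀ => ?_
    set C := fiber V ω₀ with hC
    have hfib : ∀ ω ∈ C, fiber V ω = C := fun ω hω => fiber_congr (mem_fiber.1 hω)
    have hdC : ∀ ω ∈ C, d ω = #C := fun ω hω => by simp only [hd, hfib ω hω]
    have hMC : ∀ ω ∈ C, ∀ ω' ∈ C, M ω = M ω' := fun ω hω ω' hω' =>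
      hVM _ _ ((mem_fiber.1 hω).trans (mem_fiber.1 hω').symm)
    have hCpos : (0 : ℝ) < #C := fiber_card_pos V ω₀
    have key := sum_accepted_disjoint_le hb hbn C (D ∩ C) inter_subset_right (fun ω => ω.1 i)
      (fun ω => ω.2) (fun t => by
        have := card_fiber_filter_snd_real hVS ω₀ (fun s => s = t)
        rw [filter_eq' univ t, if_pos (mem_univ _), card_singleton, Nat.cast_one, mul_one] at this
        exact this)
      (fun x => by
        by_cases hne : ((D ∩ C).filter fun ω => ω.1 i = x).Nonempty
        · obtain ⟨ω₁, h₁⟩ := hne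
          rw [mem_filter, mem_inter, hD, mem_filter] at h₁
          have h2 := h₁.1.1.2
          rw [Fintype.card_fun, Fintype.card_fin, Fintype.card_fin, hfib ω₁ h₁.1.2,
            Nat.cast_pow] at h2
          refine le_trans ?_ h2
          gcongr
          intro ω hω
          rw [mem_filter, mem_inter] at hω
          rw [mem_fiber, hω.2, h₁.2, mem_fiber.1 hω.1.2, mem_fiber.1 h₁.1.2]
        · rw [not_nonempty_iff_eq_empty.1 hne]
          simp only [card_empty, Nat.cast_zero, zero_mul]
          positivity)
      label acc dis (shortBitStrings L) (fun _ _ => Iff.rfl) (fun ω _ ω' _ h => mem_shortBitStrings h.2)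
      -- On the fibre the broadcast is constant, so both conversations follow one protocol tree.
      (fun ω₁ h₁ ω₁' h₁' ω₂ h₂ ω₂' h₂' hlab ha₁ ha₂ => by
        have hm := hMC ω₂ h₂ ω₁ h₁
        simp only [hlabel, hacc] at hlab ha₁ ha₂ ⊢
        rw [hm] at hlab ha₂
        have := TwoParty.transcript_answer_rectangle _ hlab (ha₁.1.trans ha₂.1.symm)
        rw [this.1, this.2]
        exact ⟨rfl, ha₁⟩)
    have hleft : ∑ ω ∈ C, good ω =
        (∑ ω ∈ D ∩ C, (#(C.filter fun ω' => acc ω ω' ∧ dis ω ω') : ℝ)) / #C := by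
      rw [inter_comm, ← filter_mem_eq_inter, sum_filter, sum_div]
      refine sum_congr rfl fun ω hω => ?_
      simp only [hgood]
      rw [hfib ω hω, hdC ω hω]
      split_ifs <;> simp
    have hright : ∑ ω ∈ C, (9 * (wrong ω / d ω) + η) =
        (9 * ∑ ω ∈ C, wrong ω + η * #C ^ 2) / #C := by
      rw [sum_add_distrib, sum_const, nsmul_eq_mul, ← mul_sum, add_div, mul_div_assoc, sum_div]
      congr 1
      · congr 1
        exact sum_congr rfl fun ω hω => by rw [hdC ω hω]
      · field_simp
    rw [hleft, hright]
    refine div_le_div_of_nonneg_right (key.trans ?_) hCpos.le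
    refine add_le_add (mul_le_mul_of_nonneg_left ?_ (by norm_num)) ?_
    · calc _ ≤ ∑ ω ∈ D ∩ C, wrong ω := by
            refine sum_le_sum fun ω hω => ?_
            simp only [hwrong]
            rw [hfib ω (mem_inter.1 hω).2]
            refine Nat.cast_le.2 (card_le_card fun ω' h' => ?_)
            rw [mem_filter] at h' ⊢
            exact ⟨h'.1, by tauto⟩
        _ ≤ _ := sum_le_sum_of_subset_of_nonneg inter_subset_right
            fun ω _ _ => Nat.cast_nonneg _
    · rw [hη, mul_assoc]
      gcongr
      exact_mod_cast card_shortBitStrings_le L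
  -- A quarter of all pairs are disjoint.
  have hdis_sum : N / 4 ≤ ∑ ω, (#((fiber V ω).filter fun ω' => dis ω ω') : ℝ) / d ω :=
    card_disjoint_resampled_ge (by omega) hn0 i hVS fun _ _ => Iff.rfl
  -- A disjoint pair is accepted, or is an error, or has `ω` outside `D`. The errors enter once here
  -- and nine times through `good`, hence `10 * ε`.
  have hpoint : ∀ ω, (#((fiber V ω).filter fun ω' => dis ω ω') : ℝ) / d ω ≤
      good ω + wrong ω / d ω + if ω ∈ Dᶜ then (1 : ℝ) else 0 := by
    intro ω
    have hw0 : 0 ≤ wrong ω / d ω := div_nonneg (Nat.cast_nonneg _) (dp ω).le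
    by_cases hω : ω ∈ D
    · simp only [hgood, hω, if_true, mem_compl, not_true, if_false, add_zero]
      rw [← add_div]
      refine div_le_div_of_nonneg_right ?_ (dp ω).le
      simp only [hwrong]
      rw [← Nat.cast_add]
      refine Nat.cast_le.2 (le_trans (card_le_card ?_) (card_union_le _ _))
      intro ω' h
      simp only [mem_filter, mem_union] at h ⊢
      tauto
    · simp only [hgood, hω, if_false, mem_compl, not_false_iff, if_true, zero_add]
      have : (#((fiber V ω).filter fun ω' => dis ω ω') : ℝ) / d ω ≤ 1 := by
        rw [div_le_one (dp ω)]
        exact Nat.cast_le.2 (card_filter_le _ _)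
      linarith
  have htotal := hdis_sum.trans (sum_le_sum fun ω _ => hpoint ω)
  rw [sum_add_distrib, sum_add_distrib, sum_boole, filter_mem_eq_inter, univ_inter] at htotal
  rw [sum_add_distrib, ← mul_sum, sum_const, card_univ, nsmul_eq_mul] at hgood_sum
  have hfin : N * (1 / 4) ≤ N * (10 * ε + η + (2 * ((L + 1) * Real.log 2) + 1) / (b / 256)) := by
    rw [mul_add, mul_add]
    linarith
  exact le_of_mul_le_mul_left hfin hNpos

end FourParty

/-! ### Choice of constants. -/

theorem mainTheorem1 :
    ∃ c : ℝ, 0 < c ∧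
      ∀ k u : ℕ → ℕ,
        (fun n : ℕ => (n : ℝ)) =o[atTop] (fun n : ℕ => (k n : ℝ)) →
        (fun n : ℕ => (u n : ℝ)) =o[atTop] (fun n : ℕ => (k n : ℝ)) →
        ∀ᶠ n : ℕ in atTop, ∀ Γ : FourParty n (k n),
          Γ.SolvesDisj → Γ.adviceLength ≤ u n →
            ∃ i : Fin (k n), c * Real.sqrt (n : ℝ) ≤ (Γ.length i : ℝ) := by
  -- The parameters are `b = ⌊√n⌋`, `ε = 1/100`, `r = ⌊k/2⌋`. The three terms of the constraint are
  -- then at most `1/10`, `1/20` and `1/20`, with sum below `1/4`. The bound `n ≤ k` only serves to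
  -- make `k` large enough to absorb rounding.
  refine ⟨1 / 100000, by norm_num, fun k u hk hu => ?_⟩
  filter_upwards [hk.bound one_pos, hu.bound (show (0 : ℝ) < 1 / 1000 by norm_num),
    eventually_ge_atTop (10 ^ 12)] with n hkn hun hn Γ hΓ hadv
  rw [Real.norm_natCast, Real.norm_natCast] at hkn hun
  by_contra! hcon
  set b := Nat.sqrt n with hbdef
  have hb : 10 ^ 6 ≤ b := Nat.le_sqrt.2 (by omega)
  have hbn : b ^ 2 ≤ n := Nat.sqrt_le' n
  have hbR : (10 ^ 6 : ℝ) ≤ b := by exact_mod_cast hb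
  have hsqrt : Real.sqrt n ≤ b + 1 := by
    rw [Real.sqrt_le_left (by positivity)]
    exact_mod_cast (Nat.lt_succ_sqrt' n).le
  set L := ⌊1 / 100000 * Real.sqrt n⌋₊ with hLdef
  have hLR : (L : ℝ) ≤ 1 / 100000 * Real.sqrt n := Nat.floor_le (by positivity)
  have hLb : (L : ℝ) ≤ 1 / 100000 * (b + 1) := hLR.trans (by gcongr)
  have hlen : ∀ i, Γ.length i ≤ L := fun i => Nat.le_floor (hcon i).le
  have hlog2 : Real.log 2 ≤ 1 := by linarith [Real.log_two_lt_d9]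
  have hnR : (10 ^ 12 : ℝ) ≤ n := by exact_mod_cast hn
  have hkR : (k n : ℝ) ≤ 2 * (k n / 2 : ℕ) + 1 := by
    exact_mod_cast (by omega : k n ≤ 2 * (k n / 2) + 1)
  have hur : ((u n : ℝ) + 1) * Real.log 2 < 1 / 100 * (k n / 2 : ℕ) := by
    have h1 : ((u n : ℝ) + 1) * Real.log 2 ≤ u n + 1 := mul_le_of_le_one_right (by positivity) hlog2
    linarith
  have hmain := FourParty.quarter_le_of_solvesDisj (by omega) hbn hΓ hadv hlen
    (Nat.mul_div_le (k n) 2) hur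
  have hmsg : (2 * (((L : ℝ) + 1) * Real.log 2) + 1) / (b / 256) ≤ 1 / 20 := by
    have h1 : ((L : ℝ) + 1) * Real.log 2 ≤ L + 1 := mul_le_of_le_one_right (by positivity) hlog2
    rw [div_le_iff₀ (by positivity)]
    linarith
  have herr : (2 : ℝ) ^ (L + 1) * (Real.exp (-(b / 256)) + (2 / 3) ^ b) ≤ 1 / 20 := by
    have h1 : (2 : ℝ) ^ (L + 1) ≤ Real.exp (L + 1) := by
      have : (2 : ℝ) ≤ Real.exp 1 := by linarith [Real.exp_one_gt_d9]
      calc (2 : ℝ) ^ (L + 1) ≤ Real.exp 1 ^ (L + 1) := by gcongr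
        _ = _ := by rw [← Real.exp_nat_mul]; push_cast; ring_nf
    have h2 : ((2 : ℝ) / 3) ^ b ≤ Real.exp (-(b / 256)) := by
      have : (2 / 3 : ℝ) ≤ Real.exp (-(1 / 256)) := by
        linarith [Real.one_sub_le_exp_neg (1 / 256 : ℝ)]
      calc ((2 : ℝ) / 3) ^ b ≤ Real.exp (-(1 / 256)) ^ b := by gcongr
        _ = _ := by rw [← Real.exp_nat_mul]; ring_nf
    calc (2 : ℝ) ^ (L + 1) * (Real.exp (-(b / 256)) + (2 / 3) ^ b)
        ≤ Real.exp (L + 1) * (Real.exp (-(b / 256)) + Real.exp (-(b / 256))) := by gcongr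
      _ = 2 * Real.exp (L + 1 + -(b / 256)) := by rw [Real.exp_add (L + 1 : ℝ)]; ring
      _ ≤ 2 * Real.exp (-1) ^ 4 := by
          rw [← Real.exp_nat_mul]
          gcongr
          push_cast
          linarith
      _ ≤ 2 * (37 / 100) ^ 4 := by
          gcongr
          linarith [Real.exp_neg_one_lt_d9]
      _ ≤ 1 / 20 := by norm_num
  linarith
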